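/- Let $\mathscr{X}$ be a special Kähler manifold of complex dimension $r$: a complex manifold covered by holomorphic charts $a=(a^1,\dots,a^r)$ (special coordinates), each with a holomorphic prepotential $\mathcal F(a)$ such that $\mathrm{Im}\,\tau_{ij}$ is positive definite, where $\tau_{ij}=\partial^2\mathcal F/\partial a^i\partial a^j$; the vectors $(a^i,\partial\mathcal F/\partial a^i)$ of any two of them are related, locally on the overlaps, by a transformation in $Sp(2r,\mathbb R)$ followed by a constant complex translation; and $\mathscr X$ carries the Kähler metric $G$ that reads $ds^2=\mathrm{Im}(\tau_{ij})\,da^i\,d\bar a^{\bar j}$ in each of them. Let $\tau\colon\mathscr X\to\mathscr H$ be a period map, i.e. a map to Siegel's upper half-space (symmetric complex $r\times r$ matrices with positive-definite imaginary part) which near every point is given by $\tau_{ij}=\partial^2\mathcal F/\partial a^i\partial a^j$ in some special coordinates. Let $\boldsymbol\tau\in\mathscr H$ be such that the fiber $\mathscr X_{\boldsymbol\tau}=\tau^{-1}(\boldsymbol\tau)$ is an embedded complex submanifold of $\mathscr X$, of pure dimension, with inclusion $i_{\boldsymbol\tau}\colon\mathscr X_{\boldsymbol\tau}\hookrightarrow\mathscr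 X$. **(1)** The Chern connection $\nabla^{\mathscr X}$ of $(T\mathscr X,G)$ is the Levi-Civita connection of $G$, and the restriction $i_{\boldsymbol\tau}^*T\mathscr X\to\mathscr X_{\boldsymbol\tau}$ of the holomorphic tangent bundle is flat for the restricted connection $i_{\boldsymbol\tau}^*\nabla^{\mathscr X}$. **(2)** Equip $\mathscr X_{\boldsymbol\tau}$ with the metric induced by $G$; it is Kähler (its Chern connection is its Levi-Civita connection). **(2a)** The Riemann tensor of $\mathscr X_{\boldsymbol\tau}$ is Nakano non-positive, i.e. $R_{i\bar jk\bar l}\,u^{ik}\,\bar u^{\bar j\bar l}\le 0$ for all tensors $u^{ik}$ (with the sign convention $R_{i\bar jk\bar l}=-\partial_i\partial_{\bar j}G_{k\bar l}+G^{\bar n m}\partial_iG_{k\bar n}\partial_{\bar j}G_{m\bar l}$ for a Kähler metric $G$); its Ricci form and its holomorphic bisectional curvatures are also non-positive. **(2b)** The induced metric on $\mathscr X_{\boldsymbol\tau}$ is flat if and only if $\mathscr X_{\boldsymbol\tau}$ is totally geodesic in $\mathscr X$ (its second fundamental form vanishes). In that case $\mathscr X_{\boldsymbol\tau}$ is a holomorphic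 flat, i.e. a complex submanifold which is totally geodesic and whose induced metric is flat. -/

import Mathlib

open scoped Manifold ContDiff Topology Matrix ComplexOrder ComplexConjugate

namespace SpecialGeometry

noncomputable section

/-! ### Local objects on open subsets of `ℂⁿ` -/

/-- The model space `ℂⁿ`. -/
abbrev Cn (n : ℕ) : Type := EuclideanSpace ℂ (Fin n)

/-- The `i`-th coordinate vector of `ℂⁿ`. -/
def basisVec {n : ℕ} (i : Fin n) : Cn n := EuclideanSpace.single i (1 : ℂ)

/-- Action of a square matrix on a vector of `ℂⁿ`. -/
def act {n : ℕ} (A : Matrix (Fin n) (Fin n) ℂ) (v : Cn n) : Cn n :=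
  WithLp.toLp 2 (A *ᵥ v.ofLp)

/-- The `(1,0)`-part of the differential, `∂f(v) = (df(v) - i df(iv)) / 2`. -/
def del {n : ℕ} (f : Cn n → ℂ) (z v : Cn n) : ℂ :=
  (fderiv ℝ f z v - Complex.I * fderiv ℝ f z (Complex.I • v)) / 2

/-- Connection matrices of one-forms on (an open subset of) `ℂⁿ`, acting on sections of a trivial
bundle of rank `m`: `∇_u s = D_u s + A_z(u) s`. Tangent vectors `u` are real tangent vectors,
i.e. elements of `ℂⁿ` regarded as a real vector space. -/
abbrev ConnForm (n m : ℕ) : Type := Cn n → Cn n → Matrix (Fin m) (Fin m) ℂ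

/-- The curvature `dA + A ∧ A` of a connection form, on real tangent vectors `u`, `v`. -/
def ConnForm.curvature {n m : ℕ} (A : ConnForm n m) (z u v : Cn n) :
    Matrix (Fin m) (Fin m) ℂ :=
  (Matrix.of fun i j =>
      fderiv ℝ (fun z' => A z' v i j) z u - fderiv ℝ (fun z' => A z' u i j) z v)
    + (A z u * A z v - A z v * A z u)

/-- The curvature evaluated on the pair `(u', v̄')`, where `u' = (u - i·Ju)/2` is the
`(1,0)`-part of `u` and `v̄' = (v + i·Jv)/2` the `(0,1)`-part of `v`
(the curvature two-form is extended complex-bilinearly, `J` is the complex structure). -/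
def ConnForm.curvatureMixed {n m : ℕ} (A : ConnForm n m) (z u v : Cn n) :
    Matrix (Fin m) (Fin m) ℂ :=
  (1 / 4 : ℂ) • (A.curvature z u v + Complex.I • A.curvature z u (Complex.I • v)
    - Complex.I • A.curvature z (Complex.I • u) v
    + A.curvature z (Complex.I • u) (Complex.I • v))

/-- Pull-back of a connection form under a holomorphic map `f` between open subsets of
`ℂᵏ` and `ℂⁿ`: `(f^*A)_w(u) = A_{f(w)}(df_w(u))`. -/
def ConnForm.pullback {k n m : ℕ} (A : ConnForm n m) (f : Cn k → Cn n) : ConnForm k m :=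
  fun w u => A (f w) (fderiv ℂ f w u)

/-- The Chern connection form `H⁻¹ ∂H` of a Hermitian metric on a holomorphic bundle, written in a
holomorphic frame `e_k`, where `H l k = h(e_k, e_l)` (`h` is antilinear in its second argument). -/
def chernForm {n m : ℕ} (H : Cn n → Matrix (Fin m) (Fin m) ℂ) : ConnForm n m :=
  fun z u => (H z)⁻¹ * Matrix.of fun i j => del (fun z' => H z' i j) z u

/-! ### Hermitian metrics on complex manifolds -/

section Manifold

variable {n : ℕ} {X : Type*} [TopologicalSpace X] [ChartedSpace (Cn n) X]

variable (n X) in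
/-- A pairing on each holomorphic tangent space of the complex manifold `X`. -/
abbrev TangentPairing : Type _ :=
  ∀ x : X, TangentSpace 𝓘(ℂ, Cn n) x → TangentSpace 𝓘(ℂ, Cn n) x → ℂ

variable (n X) in
/-- The holomorphic charts of the complex manifold `X`. -/
abbrev holCharts : Set (OpenPartialHomeomorph X (Cn n)) :=
  IsManifold.maximalAtlas 𝓘(ℂ, Cn n) ω X

/-- The coordinate vector field `∂/∂zᵏ` of a chart `e` at the point with coordinates `z`. -/
def coordField (e : OpenPartialHomeomorph X (Cn n)) (z : Cn n) (k : Fin n) :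
    TangentSpace 𝓘(ℂ, Cn n) (e.symm z) :=
  mfderiv 𝓘(ℂ, Cn n) 𝓘(ℂ, Cn n) e.symm z (basisVec k)

/-- The matrix of `g` in the chart `e`: its entry `(l, k)` is `g(∂_k, ∂_l)`. -/
def metricMatrix (g : TangentPairing n X) (e : OpenPartialHomeomorph X (Cn n)) (z : Cn n) :
    Matrix (Fin n) (Fin n) ℂ :=
  Matrix.of fun l k => g (e.symm z) (coordField e z k) (coordField e z l)

/-- The Chern connection of the holomorphic tangent bundle of `(X, g)` in the chart `e`. -/
def chernConn (g : TangentPairing n X) (e : OpenPartialHomeomorph X (Cn n)) : ConnForm n n :=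
  chernForm (metricMatrix g e)

/-- The Chern connection of `g` is the Levi-Civita connection: in all holomorphic charts it is
torsion-free and preserves `g`. -/
def ChernIsLeviCivita (g : TangentPairing n X) : Prop :=
  ∀ e ∈ holCharts n X, ∀ z ∈ e.target, ∀ u v : Cn n,
    act (chernConn g e z u) v = act (chernConn g e z v) u ∧
    ∀ i j : Fin n, fderiv ℝ (fun z' => metricMatrix g e z' i j) z u =
      (metricMatrix g e z * chernConn g e z u
        + (chernConn g e z u)ᴴ * metricMatrix g e z) i j

/-- The Riemann tensor `R_{i j̄ k l̄} = g(R(∂_i, ∂_j̄) ∂_k, ∂_l)` in the chart `e`. -/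
def riemann (g : TangentPairing n X) (e : OpenPartialHomeomorph X (Cn n)) (z : Cn n)
    (i j k l : Fin n) : ℂ :=
  (metricMatrix g e z * (chernConn g e).curvatureMixed z (basisVec i) (basisVec j)) l k

/-- The components `R_{i j̄}` of the Ricci form: the trace of the curvature endomorphism. -/
def ricci (g : TangentPairing n X) (e : OpenPartialHomeomorph X (Cn n)) (z : Cn n)
    (i j : Fin n) : ℂ :=
  ((chernConn g e).curvatureMixed z (basisVec i) (basisVec j)).trace

/-- Nakano non-positivity: `R_{i j̄ k l̄} u^{ik} ū^{jl} ≤ 0` for all tensors `u`.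
(The inequality between complex numbers says that the left side is real and `≤ 0`.) -/
def NakanoNonpos (g : TangentPairing n X) : Prop :=
  ∀ e ∈ holCharts n X, ∀ z ∈ e.target, ∀ u : Fin n → Fin n → ℂ,
    ∑ i, ∑ j, ∑ k, ∑ l, riemann g e z i j k l * u i k * conj (u j l) ≤ 0

/-- The Ricci form is non-positive: `R_{i j̄} uⁱ ūʲ ≤ 0` for all vectors `u`. -/
def RicciNonpos (g : TangentPairing n X) : Prop :=
  ∀ e ∈ holCharts n X, ∀ z ∈ e.target, ∀ u : Fin n → ℂ,
    ∑ i, ∑ j, ricci g e z i j * u i * conj (u j) ≤ 0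

/-- The holomorphic bisectional curvatures are non-positive:
`R_{i j̄ k l̄} uⁱ ūʲ vᵏ v̄ˡ ≤ 0` for all vectors `u`, `v`. -/
def BisectionalNonpos (g : TangentPairing n X) : Prop :=
  ∀ e ∈ holCharts n X, ∀ z ∈ e.target, ∀ u v : Fin n → ℂ,
    ∑ i, ∑ j, ∑ k, ∑ l, riemann g e z i j k l * u i * conj (u j) * v k * conj (v l) ≤ 0

/-- The metric is flat: the curvature of its Chern connection vanishes identically. -/
def IsFlat (g : TangentPairing n X) : Prop :=
  ∀ e ∈ holCharts n X, ∀ z ∈ e.target, ∀ u v : Cn n, (chernConn g e).curvature z u v = 0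

/-! ### Submanifolds -/

variable {s : ℕ} {S : Type*} [TopologicalSpace S] [ChartedSpace (Cn s) S]

/-- The metric induced on `S` by `g` through `ι : S → X`. -/
def inducedMetric (g : TangentPairing n X) (ι : S → X) : TangentPairing s S :=
  fun x u v => g (ι x) (mfderiv 𝓘(ℂ, Cn s) 𝓘(ℂ, Cn n) ι x u)
    (mfderiv 𝓘(ℂ, Cn s) 𝓘(ℂ, Cn n) ι x v)

/-- The expression of `ι : S → X` in a chart `d` of `S` and a chart `e` of `X`. -/
def inCharts (ι : S → X) (d : OpenPartialHomeomorph S (Cn s))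
    (e : OpenPartialHomeomorph X (Cn n)) : Cn s → Cn n :=
  fun w => e (ι (d.symm w))

/-- The restriction `ι^*∇` of the Chern connection `∇` of `(X, g)`, a connection on the bundle
`ι^*TX` over `S`, in a chart `d` of `S` and the frame of `ι^*TX` given by a chart `e` of `X`. -/
def restrictedConn (g : TangentPairing n X) (ι : S → X) (d : OpenPartialHomeomorph S (Cn s))
    (e : OpenPartialHomeomorph X (Cn n)) : ConnForm s n :=
  (chernConn g e).pullback (inCharts ι d e)

/-- The bundle `ι^*TX → S` is flat for the restricted connection `ι^*∇`. -/
def RestrictedTangentFlat (g : TangentPairing n X) (ι : S → X) : Prop :=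
  ∀ d ∈ holCharts s S, ∀ e ∈ holCharts n X, ∀ w ∈ d.target, ι (d.symm w) ∈ e.source →
    ∀ u v : Cn s, (restrictedConn g ι d e).curvature w u v = 0

/-- `S` is totally geodesic in `(X, g)`: its second fundamental form vanishes, i.e. the ambient
covariant derivative `(ι^*∇)_u (dι V)` is tangent to `S` for every coordinate vector field
`V ≡ v` and every tangent vector `u` of `S`. -/
def IsTotallyGeodesic (g : TangentPairing n X) (ι : S → X) : Prop :=
  ∀ d ∈ holCharts s S, ∀ e ∈ holCharts n X, ∀ w ∈ d.target, ι (d.symm w) ∈ e.source →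
    ∀ u v : Cn s, ∃ t : Cn s,
      fderiv ℝ (fun w' => fderiv ℂ (inCharts ι d e) w' v) w u
        + act (restrictedConn g ι d e w u) (fderiv ℂ (inCharts ι d e) w v)
      = fderiv ℂ (inCharts ι d e) w t

/-- `S` is a holomorphic flat of `(X, g)`: a complex submanifold that is totally geodesic and
whose induced metric is flat. -/
structure IsHolomorphicFlat (g : TangentPairing n X) (ι : S → X) : Prop where
  embedding : Manifold.IsSmoothEmbedding 𝓘(ℂ, Cn s) 𝓘(ℂ, Cn n) ω ι
  totallyGeodesic : IsTotallyGeodesic (s := s) g ι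
  flat : IsFlat (inducedMetric (s := s) g ι)

end Manifold

/-! ### Special Kähler manifolds and their period maps -/

/-- The gradient `∂F/∂aⁱ` of a holomorphic function. -/
def gradient {r : ℕ} (F : Cn r → ℂ) (a : Cn r) (i : Fin r) : ℂ :=
  fderiv ℂ F a (basisVec i)

/-- The matrix `∂²F/∂aⁱ∂aʲ` of a holomorphic function. -/
def hessian {r : ℕ} (F : Cn r → ℂ) (a : Cn r) : Matrix (Fin r) (Fin r) ℂ :=
  Matrix.of fun i j => fderiv ℂ (fun a' => gradient F a' i) a (basisVec j)

/-- Siegel's upper half-space: symmetric complex matrices with positive-definite imaginary part. -/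
def SiegelSpace (r : ℕ) : Type :=
  {M : Matrix (Fin r) (Fin r) ℂ // M.IsSymm ∧ (M.map Complex.im).PosDef}

/-- Special coordinates `a` on an open subset of the complex manifold `X`, together with a
holomorphic prepotential `F` whose Hessian has positive-definite imaginary part. -/
structure SpecialChart (r : ℕ) (X : Type*) [TopologicalSpace X] [ChartedSpace (Cn r) X] where
  /-- the special coordinates -/
  a : OpenPartialHomeomorph X (Cn r)
  a_mem : a ∈ holCharts r X
  /-- the prepotential -/
  F : Cn r → ℂ
  holomorphic : DifferentiableOn ℂ F a.target
  posDef : ∀ z ∈ a.target, ((hessian F z).map Complex.im).PosDef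

namespace SpecialChart

variable {r : ℕ} {X : Type*} [TopologicalSpace X] [ChartedSpace (Cn r) X]

/-- The matrix `τ_{ij} = ∂²F/∂aⁱ∂aʲ` as a function on `X`. -/
def periodMatrix (c : SpecialChart r X) (x : X) : Matrix (Fin r) (Fin r) ℂ :=
  hessian c.F (c.a x)

/-- The vector `(aⁱ, ∂F/∂aⁱ)` of all `2r` special periods. -/
def periods (c : SpecialChart r X) (x : X) : Fin r ⊕ Fin r → ℂ :=
  Sum.elim (c.a x).ofLp (gradient c.F (c.a x))

/-- Components `daⁱ(v)` of a tangent vector in special coordinates. -/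
def da (c : SpecialChart r X) (x : X) (v : TangentSpace 𝓘(ℂ, Cn r) x) : Cn r :=
  mfderiv 𝓘(ℂ, Cn r) 𝓘(ℂ, Cn r) c.a x v

end SpecialChart

/-- A special Kähler structure on a complex manifold `X` of dimension `r`: an atlas of special
coordinates, related by real symplectic transformations and complex translations of the periods
`(a, ∂F/∂a)`, and the Kähler metric given by `Im(τ_{ij}) daⁱ dāʲ` in all of them. -/
structure SpecialKahlerStructure (r : ℕ) (X : Type*) [TopologicalSpace X]
    [ChartedSpace (Cn r) X] where
  /-- the special Kähler metric -/
  metric : TangentPairing r X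
  /-- the special coordinate systems -/
  charts : Set (SpecialChart r X)
  cover : ∀ x : X, ∃ c ∈ charts, x ∈ c.a.source
  transition : ∀ c ∈ charts, ∀ c' ∈ charts, ∀ x ∈ c.a.source ∩ c'.a.source,
    ∃ M ∈ Matrix.symplecticGroup (Fin r) ℝ, ∃ b : Fin r ⊕ Fin r → ℂ,
      ∀ᶠ y in 𝓝 x, c'.periods y = M.map Complex.ofReal *ᵥ c.periods y + b
  metric_eq : ∀ c ∈ charts, ∀ x ∈ c.a.source, ∀ v w : TangentSpace 𝓘(ℂ, Cn r) x,
    metric x v w = ∑ i, ∑ j, ((c.periodMatrix x i j).im : ℂ) * c.da x v i * conj (c.da x w j)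

/-- `τ : X → ℋ` is a period map of a special Kähler structure, to Siegel's upper half-space:
near each point it is given by `∂²F/∂aⁱ∂aʲ` in some special coordinates. -/
def IsPeriodMap {r : ℕ} {X : Type*} [TopologicalSpace X] [ChartedSpace (Cn r) X]
    (K : SpecialKahlerStructure r X) (τ : X → SiegelSpace r) : Prop :=
  ∀ x : X, ∃ c ∈ K.charts, x ∈ c.a.source ∧ ∀ᶠ y in 𝓝 x, (τ y).1 = c.periodMatrix y

end

end SpecialGeometry

open SpecialGeometry

/-!
In special coordinates the metric of a special Kähler manifold has the matrix `Im τ`, and symmetry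
of the third derivatives of the prepotential makes its Chern connection torsion-free. Along a fiber
of the period map, the special coordinates around a point have constant `Im τ = H`, so the ambient
connection form vanishes there and the restricted connection is pure gauge, hence flat. In these
coordinates the fiber is a holomorphic immersion `f` into `ℂʳ` with the constant Hermitian metric
`H`, whose induced metric has the matrix `H' = J* H J` for the Jacobian `J` of `f`. With the
orthogonal projection `N` onto the normal space, Gauss' equation reads
`H' R(u, v̄) = -(∂_v J)* (H N) (∂_u J)`. Since `H N` is positive semidefinite, the curvature is
Nakano non-positive, and it vanishes exactly when `N ∂_u J = 0`, i.e. when the second derivatives of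
`f` are tangent to the fiber.
-/

namespace SpecialGeometry

section Holomorphic

variable {E F : Type*} [NormedAddCommGroup E] [NormedSpace ℂ E]
  [NormedAddCommGroup F] [NormedSpace ℂ F]

theorem norm_fderiv_le_of_norm_le_on_ball {f : E → F} {x : E} {R M : ℝ} (hR : 0 < R)
    (hf : DifferentiableOn ℂ f (Metric.ball x R)) (hM : ∀ z ∈ Metric.ball x R, ‖f z‖ ≤ M) :
    ‖fderiv ℂ f x‖ ≤ 2 * M / R := by
  refine Complex.norm_fderiv_le_div_of_mapsTo_ball hf (fun z hz => ?_) hR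
  rw [mem_closedBall_iff_norm]
  linarith [norm_sub_le (f z) (f x), hM z hz, hM x (Metric.mem_ball_self hR)]

theorem norm_fderiv_le_of_norm_le_on_ball_add {f : E → F} {x y : E} {r δ M : ℝ} (hδ : 0 < δ)
    (hf : DifferentiableOn ℂ f (Metric.ball x (r + δ)))
    (hM : ∀ z ∈ Metric.ball x (r + δ), ‖f z‖ ≤ M) (hy : y ∈ Metric.ball x r) :
    ‖fderiv ℂ f y‖ ≤ 2 * M / δ := by
  have hsub : Metric.ball y δ ⊆ Metric.ball x (r + δ) :=
    Metric.ball_subset_ball' (by linarith [Metric.mem_ball.1 hy])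
  exact norm_fderiv_le_of_norm_le_on_ball hδ (hf.mono hsub) fun z hz => hM z (hsub hz)

theorem uniformCauchySeqOn_fderiv {ι : Type*} {l : Filter ι} {f : ι → E → F} {x : E} {r δ : ℝ}
    (hδ : 0 < δ) (hf : ∀ i, DifferentiableOn ℂ (f i) (Metric.ball x (r + δ)))
    (hcauchy : UniformCauchySeqOn f l (Metric.ball x (r + δ))) :
    UniformCauchySeqOn (fun i => fderiv ℂ (f i)) l (Metric.ball x r) := by
  intro V hV
  obtain ⟨ε, hε, hεV⟩ := Metric.mem_uniformity_dist.1 hV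
  have hε' : 0 < ε * δ / 4 := by positivity
  filter_upwards [hcauchy _ (Metric.dist_mem_uniformity hε')] with p hp y hy
  have hsub : fderiv ℂ (fun z => f p.1 z - f p.2 z) y = fderiv ℂ (f p.1) y - fderiv ℂ (f p.2) y :=
    have hy' := Metric.isOpen_ball.mem_nhds (Metric.ball_subset_ball (by linarith) hy)
    fderiv_fun_sub ((hf p.1).differentiableAt hy') ((hf p.2).differentiableAt hy')
  refine hεV ?_
  rw [dist_eq_norm, ← hsub]
  calc _ ≤ 2 * (ε * δ / 4) / δ :=
        norm_fderiv_le_of_norm_le_on_ball_add hδ ((hf p.1).sub (hf p.2))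
          (fun z hz => by simpa [dist_eq_norm] using (hp z hz).le) hy
    _ < ε := by field_simp; linarith

theorem differentiableOn_of_tendstoUniformlyOn [CompleteSpace F] {ι : Type*} {l : Filter ι}
    [l.NeBot] {f : ι → E → F} {g : E → F} {x : E} {r δ : ℝ} (hδ : 0 < δ)
    (hf : ∀ i, DifferentiableOn ℂ (f i) (Metric.ball x (r + δ)))
    (hlim : TendstoUniformlyOn f g l (Metric.ball x (r + δ))) :
    DifferentiableOn ℂ g (Metric.ball x r) := by
  have hcauchy := uniformCauchySeqOn_fderiv hδ hf hlim.uniformCauchySeqOn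
  have hsub : Metric.ball x r ⊆ Metric.ball x (r + δ) := Metric.ball_subset_ball (by linarith)
  choose! g' hg' using fun y (hy : y ∈ Metric.ball x r) =>
    cauchy_map_iff_exists_tendsto.1 (hcauchy.cauchy_map hy)
  intro y hy
  refine (hasFDerivAt_of_tendstoUniformlyOn Metric.isOpen_ball
    (hcauchy.tendstoUniformlyOn_of_tendsto hg') (fun i z hz => ?_)
    (fun z hz => hlim.tendsto_at (hsub hz)) hy).differentiableAt.differentiableWithinAt
  exact ((hf i).differentiableAt (Metric.isOpen_ball.mem_nhds (hsub hz))).hasFDerivAt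

theorem norm_sub_sub_fderiv_le {f : E → F} {x z : E} {R M : ℝ}
    (hf : DifferentiableOn ℂ f (Metric.ball x R)) (hM : ∀ y ∈ Metric.ball x R, ‖f y‖ ≤ M)
    (hz : z ∈ Metric.ball x R) :
    ‖f z - f x - fderiv ℂ f x (z - x)‖ ≤ 4 * M * (‖z - x‖ / R) ^ 2 := by
  have hR : 0 < R := Metric.nonempty_ball.1 ⟨z, hz⟩
  have hx : x ∈ Metric.ball x R := Metric.mem_ball_self hR
  set g : E → F := fun y => f y - fderiv ℂ f x (y - x) with hg
  have hgsub : ∀ y, g y - g x = f y - f x - fderiv ℂ f x (y - x) := fun y => by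
    simp only [hg, sub_self, map_zero, sub_zero, sub_right_comm]
  have hgdiff : DifferentiableOn ℂ g (Metric.ball x R) :=
    hf.sub (by fun_prop)
  have hmaps : Set.MapsTo g (Metric.ball x R) (Metric.closedBall (g x) (4 * M)) := by
    intro y hy
    have hD : ‖fderiv ℂ f x (y - x)‖ ≤ 2 * M := calc
      _ ≤ 2 * M / R * R := ContinuousLinearMap.le_of_opNorm_le_of_le _
        (norm_fderiv_le_of_norm_le_on_ball hR hf hM) (mem_ball_iff_norm.1 hy).le
      _ = 2 * M := div_mul_cancel₀ _ hR.ne'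
    rw [mem_closedBall_iff_norm, hgsub]
    linarith [norm_sub_le (f y - f x) (fderiv ℂ f x (y - x)), norm_sub_le (f y) (f x),
      hM y hy, hM x hx]
  have hlittle : (fun y => g y - g x) =o[𝓝 x] fun y => ‖y - x‖ ^ 1 := by
    simp only [hgsub, pow_one]
    exact (hf.differentiableAt (Metric.isOpen_ball.mem_nhds hx)).hasFDerivAt.isLittleO.norm_right
  have h := Complex.dist_le_mul_div_pow_of_mapsTo_ball_of_isLittleO hgdiff hmaps hlittle hz
  simpa only [dist_eq_norm, hgsub, Nat.reduceAdd] using h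

theorem norm_diffQuotient_sub_fderiv_le {f : E → F} {x v : E} {t : ℂ} {R M : ℝ} (ht : t ≠ 0)
    (hf : DifferentiableOn ℂ f (Metric.ball x R)) (hM : ∀ y ∈ Metric.ball x R, ‖f y‖ ≤ M)
    (htv : ‖t • v‖ < R) :
    ‖t⁻¹ • (f (x + t • v) - f x) - fderiv ℂ f x v‖ ≤ 4 * M * (‖v‖ / R) ^ 2 * ‖t‖ := by
  have htaylor := norm_sub_sub_fderiv_le (z := x + t • v) hf hM (by simpa using htv)
  have hfactor : t⁻¹ • (f (x + t • v) - f x) - fderiv ℂ f x v =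
      t⁻¹ • (f (x + t • v) - f x - fderiv ℂ f x (x + t • v - x)) := by
    rw [add_sub_cancel_left, map_smul, smul_sub _ (_ - _), inv_smul_smul₀ ht]
  rw [hfactor, norm_smul, norm_inv, inv_mul_le_iff₀ (norm_pos_iff.2 ht)]
  refine htaylor.trans_eq ?_
  rw [add_sub_cancel_left, norm_smul]
  ring

theorem differentiableAt_fderiv_apply [CompleteSpace F] {f : E → F} {x : E}
    (hf : ∀ᶠ y in 𝓝 x, DifferentiableAt ℂ f y) (v : E) :
    DifferentiableAt ℂ (fun y => fderiv ℂ f y v) x := by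
  have hbound : ∀ᶠ y in 𝓝 x, ‖f y‖ ≤ ‖f x‖ + 1 :=
    hf.self_of_nhds.continuousAt.norm.eventually_le_const (lt_add_one _)
  obtain ⟨ε, hε, hball⟩ := Metric.eventually_nhds_iff_ball.1 (hf.and hbound)
  obtain ⟨δ, hδ, rfl⟩ : ∃ δ > 0, ε = δ + δ + δ := ⟨ε / 3, by positivity, by ring⟩
  have hsub : ∀ y ∈ Metric.ball x (δ + δ), Metric.ball y δ ⊆ Metric.ball x (δ + δ + δ) :=
    fun y hy => Metric.ball_subset_ball' (by linarith [Metric.mem_ball.1 hy])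
  obtain ⟨t, -, ht, htlim⟩ := exists_seq_strictAnti_tendsto' (y := δ / (‖v‖ + 1)) (by positivity)
  have ht0 : ∀ n, (t n : ℂ) ≠ 0 := fun n => Complex.ofReal_ne_zero.2 (ht n).1.ne'
  have htv : ∀ n, ‖(t n : ℂ) • v‖ < δ := fun n => by
    have h := (lt_div_iff₀ (by positivity)).1 (ht n).2
    rw [norm_smul, Complex.norm_of_nonneg (ht n).1.le]
    linarith [(ht n).1]
  refine (differentiableOn_of_tendstoUniformlyOn (l := Filter.atTop) (r := δ) hδ
    (f := fun n y => (t n : ℂ)⁻¹ • (f (y + (t n : ℂ) • v) - f y)) (fun n y hy => ?_)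
    ?_).differentiableAt (Metric.ball_mem_nhds x hδ)
  · have hy' := hball _ (hsub y hy (Metric.mem_ball_self hδ))
    have htvy := hball _ (hsub y hy (by simpa using htv n : y + (t n : ℂ) • v ∈ _))
    exact (((htvy.1.comp y (by fun_prop)).sub hy'.1).const_smul _).differentiableWithinAt
  · have hlim : Filter.Tendsto (fun n => 4 * (‖f x‖ + 1) * (‖v‖ / δ) ^ 2 * ‖(t n : ℂ)‖)
        Filter.atTop (𝓝 0) := by
      simpa using (htlim.abs.const_mul (4 * (‖f x‖ + 1) * (‖v‖ / δ) ^ 2))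
    rw [Metric.tendstoUniformlyOn_iff]
    intro η hη
    filter_upwards [hlim.eventually_lt_const hη] with n hn y hy
    rw [dist_comm, dist_eq_norm]
    exact (norm_diffQuotient_sub_fderiv_le (ht0 n)
      (fun z hz => (hball z (hsub y hy hz)).1.differentiableWithinAt)
      (fun z hz => (hball z (hsub y hy hz)).2) (htv n)).trans_lt hn

theorem contDiffOn_infty_of_differentiableOn [FiniteDimensional ℂ E] [CompleteSpace F] {f : E → F}
    {U : Set E} (hU : IsOpen U) (hf : DifferentiableOn ℂ f U) : ContDiffOn ℂ ∞ f U := by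
  refine contDiffOn_infty.2 fun n => ?_
  induction n generalizing f with
  | zero => exact contDiffOn_zero.2 hf.continuousOn
  | succ n ih =>
    rw [Nat.cast_succ, contDiffOn_succ_iff_fderiv_of_isOpen hU]
    refine ⟨hf, by simp, contDiffOn_clm_apply.2 fun v => ih fun z hz => ?_⟩
    exact (differentiableAt_fderiv_apply (hf.eventually_differentiableAt (hU.mem_nhds hz))
      v).differentiableWithinAt

end Holomorphic

section Field

variable {𝕜 R E : Type*} [NontriviallyNormedField 𝕜] [NormedField R] [NormedAlgebra 𝕜 R]
  [NormedAddCommGroup E] [NormedSpace 𝕜 E]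
  {l m n : Type*} {z : E}

section Finite

variable [Finite n]

theorem differentiableAt_matrix {M : E → Matrix m n R} :
    DifferentiableAt 𝕜 M z ↔ ∀ i j, DifferentiableAt 𝕜 (fun z' => M z' i j) z := by
  have := Fintype.ofFinite n
  exact differentiableAt_pi.trans (forall_congr' fun _ => differentiableAt_pi)

theorem fderiv_matrix_apply {M : E → Matrix m n R} (hM : DifferentiableAt 𝕜 M z) (u : E)
    (i : m) (j : n) : fderiv 𝕜 M z u i j = fderiv 𝕜 (fun z' => M z' i j) z u := by
  have := Fintype.ofFinite n
  have hrow : DifferentiableAt 𝕜 (fun z' => M z' i) z := differentiableAt_pi.1 hM i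
  rw [fderiv_apply hrow j, fderiv_apply hM i]
  rfl

theorem differentiableAt_matrix_comp {E' : Type*} [NormedAddCommGroup E'] [NormedSpace 𝕜 E']
    {M : E' → Matrix m n R} {f : E → E'} (hM : DifferentiableAt 𝕜 M (f z))
    (hf : DifferentiableAt 𝕜 f z) : DifferentiableAt 𝕜 (fun z' => M (f z')) z :=
  differentiableAt_matrix.2 fun i j => (differentiableAt_matrix.1 hM i j).comp z hf

theorem fderiv_matrix_comp {E' : Type*} [NormedAddCommGroup E'] [NormedSpace 𝕜 E']
    {M : E' → Matrix m n R} {f : E → E'} (hM : DifferentiableAt 𝕜 M (f z))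
    (hf : DifferentiableAt 𝕜 f z) (u : E) :
    fderiv 𝕜 (fun z' => M (f z')) z u = fderiv 𝕜 M (f z) (fderiv 𝕜 f z u) := by
  ext i j
  rw [fderiv_matrix_apply (differentiableAt_matrix_comp hM hf), fderiv_matrix_apply hM,
    fderiv_fun_comp z (differentiableAt_matrix.1 hM i j) hf, ContinuousLinearMap.comp_apply]

theorem differentiableAt_matrix_mul [Fintype m] {M : E → Matrix l m R} {N : E → Matrix m n R}
    (hM : DifferentiableAt 𝕜 M z) (hN : DifferentiableAt 𝕜 N z) :
    DifferentiableAt 𝕜 (fun z' => M z' * N z') z := by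
  simp only [differentiableAt_matrix, Matrix.mul_apply] at hM hN ⊢
  exact fun i j => DifferentiableAt.fun_sum fun k _ => (hM i k).mul (hN k j)

theorem fderiv_matrix_mul [Fintype m] {M : E → Matrix l m R} {N : E → Matrix m n R}
    (hM : DifferentiableAt 𝕜 M z) (hN : DifferentiableAt 𝕜 N z) (u : E) :
    fderiv 𝕜 (fun z' => M z' * N z') z u = fderiv 𝕜 M z u * N z + M z * fderiv 𝕜 N z u := by
  have hM' := differentiableAt_matrix.1 hM
  have hN' := differentiableAt_matrix.1 hN
  ext i j
  rw [fderiv_matrix_apply (differentiableAt_matrix_mul hM hN)]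
  have hsum : HasFDerivAt (fun z' => ∑ k, M z' i k * N z' k j) _ z :=
    HasFDerivAt.fun_sum fun k _ => (hM' i k).hasFDerivAt.mul (hN' k j).hasFDerivAt
  refine (congrArg (· u) hsum.fderiv).trans ?_
  simp only [sum_apply, add_apply, smul_apply, smul_eq_mul, Finset.sum_add_distrib,
    Matrix.add_apply, Matrix.mul_apply, fderiv_matrix_apply hM, fderiv_matrix_apply hN]
  rw [add_comm]
  simp only [mul_comm]

end Finite

variable [Fintype n]

theorem differentiableAt_matrix_det [DecidableEq n] {M : E → Matrix n n R}
    (hM : DifferentiableAt 𝕜 M z) : DifferentiableAt 𝕜 (fun z' => (M z').det) z := by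
  have hM' := differentiableAt_matrix.1 hM
  simp only [Matrix.det_apply']
  refine DifferentiableAt.fun_sum fun σ _ => DifferentiableAt.const_mul ?_ _
  exact (HasFDerivAt.finsetProd (g := fun i z' => M z' (σ i) i)
    fun i _ => (hM' _ _).hasFDerivAt).differentiableAt

theorem differentiableAt_matrix_inv [DecidableEq n] {M : E → Matrix n n R}
    (hM : DifferentiableAt 𝕜 M z) (hdet : IsUnit (M z).det) :
    DifferentiableAt 𝕜 (fun z' => (M z')⁻¹) z := by
  refine differentiableAt_matrix.2 fun i j => ?_
  simp only [Matrix.inv_def, Ring.inverse_eq_inv', Matrix.smul_apply, smul_eq_mul,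
    Matrix.adjugate_apply]
  refine ((differentiableAt_matrix_det hM).inv hdet.ne_zero).mul
    (differentiableAt_matrix_det (differentiableAt_matrix.2 fun a b => ?_))
  simp only [Matrix.updateRow_apply]
  split_ifs
  exacts [differentiableAt_const _, differentiableAt_matrix.1 hM a b]

end Field

section RestrictScalars

variable {E : Type*} [NormedAddCommGroup E] [NormedSpace ℝ E] [NormedSpace ℂ E]
  [IsScalarTower ℝ ℂ E] {m n : Type*} [Finite n] {z : E}

theorem fderiv_real_apply {F : Type*} [NormedAddCommGroup F] [NormedSpace ℝ F] [NormedSpace ℂ F]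
    [IsScalarTower ℝ ℂ F] {f : E → F} (hf : DifferentiableAt ℂ f z) (v : E) :
    fderiv ℝ f z v = fderiv ℂ f z v := by
  rw [hf.fderiv_restrictScalars ℝ, ContinuousLinearMap.coe_restrictScalars']

theorem differentiableAt_real_matrix {M : E → Matrix m n ℂ} (hM : DifferentiableAt ℂ M z) :
    DifferentiableAt ℝ M z :=
  differentiableAt_matrix.2 fun i j => (differentiableAt_matrix.1 hM i j).restrictScalars ℝ

theorem fderiv_real_matrix_apply {M : E → Matrix m n ℂ} (hM : DifferentiableAt ℂ M z) (v : E) :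
    fderiv ℝ M z v = fderiv ℂ M z v := by
  ext i j
  rw [fderiv_matrix_apply (differentiableAt_real_matrix hM), fderiv_matrix_apply hM,
    fderiv_real_apply (differentiableAt_matrix.1 hM i j)]

end RestrictScalars

section Conjugate

variable {𝕜 E : Type*} [RCLike 𝕜] [NormedAddCommGroup E] [NormedSpace ℝ E]
  {m n : Type*} [Finite m] [Finite n] {M : E → Matrix m n 𝕜} {z : E}

theorem differentiableAt_matrix_conjTranspose (hM : DifferentiableAt ℝ M z) :
    DifferentiableAt ℝ (fun z' => (M z')ᴴ) z :=
  differentiableAt_matrix.2 fun i j => (differentiableAt_matrix.1 hM j i).star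

theorem fderiv_matrix_conjTranspose (hM : DifferentiableAt ℝ M z) (u : E) :
    fderiv ℝ (fun z' => (M z')ᴴ) z u = (fderiv ℝ M z u)ᴴ := by
  ext i j
  rw [fderiv_matrix_apply (differentiableAt_matrix_conjTranspose hM), Matrix.conjTranspose_apply,
    fderiv_matrix_apply hM]
  exact congrArg (· u) (fderiv_star (𝕜 := ℝ) (f := fun z' => M z' j i))

end Conjugate

section MatrixDel

variable {k : ℕ} {l m n : Type*} {z : Cn k}

/-- The `(1,0)`-part `∂M(v) = (dM(v) - i dM(iv)) / 2` of the differential of a matrix-valued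
function, whose entries are given by `del`. -/
noncomputable def matrixDel (M : Cn k → Matrix m n ℂ) (z v : Cn k) : Matrix m n ℂ :=
  (1 / 2 : ℂ) • (fderiv ℝ M z v - Complex.I • fderiv ℝ M z (Complex.I • v))

theorem matrixDel_const (M : Matrix m n ℂ) (v : Cn k) : matrixDel (fun _ => M) z v = 0 := by
  simp [matrixDel]

theorem matrixDel_congr {M N : Cn k → Matrix m n ℂ} (h : M =ᶠ[𝓝 z] N) :
    matrixDel M z = matrixDel N z := by
  ext1 v
  rw [matrixDel, matrixDel, h.fderiv_eq]

variable [Finite n]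

theorem matrixDel_apply {M : Cn k → Matrix m n ℂ} (hM : DifferentiableAt ℝ M z)
    (v : Cn k) (i : m) (j : n) : matrixDel M z v i j = del (fun z' => M z' i j) z v := by
  simp only [matrixDel, del, Matrix.smul_apply, Matrix.sub_apply, fderiv_matrix_apply hM,
    smul_eq_mul]
  ring

theorem matrixDel_eq_fderiv {M : Cn k → Matrix m n ℂ} (hM : DifferentiableAt ℂ M z) (v : Cn k) :
    matrixDel M z v = fderiv ℂ M z v := by
  rw [matrixDel, fderiv_real_matrix_apply hM, fderiv_real_matrix_apply hM, map_smul,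
    smul_smul, Complex.I_mul_I]
  module

theorem matrixDel_comp {j : ℕ} {f : Cn j → Cn k} {M : Cn k → Matrix m n ℂ} {w : Cn j}
    (hM : DifferentiableAt ℝ M (f w)) (hf : DifferentiableAt ℂ f w) (v : Cn j) :
    matrixDel (fun w' => M (f w')) w v = matrixDel M (f w) (fderiv ℂ f w v) := by
  have hf' := hf.restrictScalars ℝ
  simp only [matrixDel, fderiv_matrix_comp hM hf', fderiv_real_apply hf, map_smul]

theorem matrixDel_mul [Fintype m] {M : Cn k → Matrix l m ℂ} {N : Cn k → Matrix m n ℂ}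
    (hM : DifferentiableAt ℝ M z) (hN : DifferentiableAt ℝ N z) (v : Cn k) :
    matrixDel (fun z' => M z' * N z') z v = matrixDel M z v * N z + M z * matrixDel N z v := by
  simp only [matrixDel, fderiv_matrix_mul hM hN, Matrix.smul_mul, Matrix.mul_smul,
    Matrix.sub_mul, Matrix.mul_sub]
  module

theorem matrixDel_conjTranspose [Finite m] {M : Cn k → Matrix m n ℂ} (hM : DifferentiableAt ℂ M z)
    (v : Cn k) : matrixDel (fun z' => (M z')ᴴ) z v = 0 := by
  have hM' := differentiableAt_real_matrix hM
  rw [matrixDel, fderiv_matrix_conjTranspose hM', fderiv_matrix_conjTranspose hM',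
    fderiv_real_matrix_apply hM, fderiv_real_matrix_apply hM, map_smul,
    Matrix.conjTranspose_smul, smul_smul]
  simp

theorem matrixDel_conjTranspose_mul_mul [Fintype m] {J : Cn k → Matrix m n ℂ}
    {H : Cn k → Matrix m m ℂ} (hJ : DifferentiableAt ℂ J z) (hH : DifferentiableAt ℝ H z)
    (v : Cn k) :
    matrixDel (fun z' => (J z')ᴴ * H z' * J z') z v
      = (J z)ᴴ * (matrixDel H z v * J z + H z * fderiv ℂ J z v) := by
  have hJ' := differentiableAt_real_matrix hJ
  have hJH := differentiableAt_matrix_conjTranspose hJ'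
  rw [matrixDel_mul (differentiableAt_matrix_mul hJH hH) hJ', matrixDel_mul hJH hH,
    matrixDel_conjTranspose hJ, matrixDel_eq_fderiv hJ, Matrix.zero_mul, zero_add, Matrix.mul_add,
    Matrix.mul_assoc, Matrix.mul_assoc]

end MatrixDel

section SecondDerivative

variable {E : Type*} [NormedAddCommGroup E] [NormedSpace ℝ E] {m n : Type*} [Finite n]
  {M : E → Matrix m n ℂ} {z : E}

theorem eventually_differentiableAt_matrix [Finite m]
    (hM : ∀ i j, ContDiffAt ℝ 2 (fun z' => M z' i j) z) :
    ∀ᶠ z' in 𝓝 z, DifferentiableAt ℝ M z' := by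
  simp only [differentiableAt_matrix, Filter.eventually_all]
  exact fun i j => ((hM i j).eventually (by simp)).mono fun z' h => h.differentiableAt (by simp)

theorem fderiv_matrix_apply_eventuallyEq [Finite m]
    (hM : ∀ i j, ContDiffAt ℝ 2 (fun z' => M z' i j) z) (u : E) (i : m) (j : n) :
    (fun z' => fderiv ℝ M z' u i j) =ᶠ[𝓝 z] fun z' => fderiv ℝ (fun z'' => M z'' i j) z' u :=
  (eventually_differentiableAt_matrix hM).mono fun _ h => fderiv_matrix_apply h u i j

theorem differentiableAt_fderiv_matrix [Finite m]
    (hM : ∀ i j, ContDiffAt ℝ 2 (fun z' => M z' i j) z) (u : E) :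
    DifferentiableAt ℝ (fun z' => fderiv ℝ M z' u) z :=
  differentiableAt_matrix.2 fun i j =>
    ((((hM i j).fderiv_right (m := 1) (by norm_num)).differentiableAt (by simp)).clm_apply
      (differentiableAt_const u)).congr_of_eventuallyEq (fderiv_matrix_apply_eventuallyEq hM u i j)

theorem fderiv_fderiv_matrix_comm [Finite m]
    (hM : ∀ i j, ContDiffAt ℝ 2 (fun z' => M z' i j) z) (u v : E) :
    fderiv ℝ (fun z' => fderiv ℝ M z' v) z u = fderiv ℝ (fun z' => fderiv ℝ M z' u) z v := by
  ext i j
  have hsymm : IsSymmSndFDerivAt ℝ (fun z' => M z' i j) z :=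
    (hM i j).isSymmSndFDerivAt (by simp)
  have hsnd (u v : E) : fderiv ℝ (fun z' => fderiv ℝ M z' v) z u i j
      = fderiv ℝ (fderiv ℝ fun z' => M z' i j) z u v := by
    rw [fderiv_matrix_apply (differentiableAt_fderiv_matrix hM v),
      (fderiv_matrix_apply_eventuallyEq hM v i j).fderiv_eq, fderiv_clm_apply
        (((hM i j).fderiv_right (m := 1) (by norm_num)).differentiableAt (by simp))
        (differentiableAt_const v)]
    simp
  rw [hsnd, hsnd, hsymm.eq]

end SecondDerivative

section ConnectionForm

variable {k n m : ℕ} {z : Cn k}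

theorem ConnForm.curvature_congr {A B : ConnForm k m} (h : A =ᶠ[𝓝 z] B) :
    A.curvature z = B.curvature z := by
  have hfderiv (u : Cn k) (i j : Fin m) :
      fderiv ℝ (fun z' => A z' u i j) z = fderiv ℝ (fun z' => B z' u i j) z :=
    (h.fun_comp fun a => a u i j).fderiv_eq
  ext u v i j
  simp only [ConnForm.curvature, h.eq_of_nhds, hfderiv]

theorem ConnForm.curvature_eq {A : ConnForm k m}
    (hA : ∀ u, DifferentiableAt ℝ (fun z' => A z' u) z) (u v : Cn k) :
    A.curvature z u v = fderiv ℝ (fun z' => A z' v) z u - fderiv ℝ (fun z' => A z' u) z v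
      + (A z u * A z v - A z v * A z u) := by
  ext i j
  simp only [ConnForm.curvature, Matrix.add_apply, Matrix.sub_apply, Matrix.of_apply,
    fderiv_matrix_apply (hA _)]

/-- Differentiating `P * J = 1` turns the term `P dJ ∧ P dJ` of the curvature into
`-dP ∧ J P dJ`, while symmetry of second derivatives leaves `dP ∧ dJ` of its exterior derivative. -/
theorem ConnForm.curvature_of_eq_mul_fderiv {A : ConnForm k m}
    {J : Cn k → Matrix (Fin n) (Fin m) ℂ} {P : Cn k → Matrix (Fin m) (Fin n) ℂ}
    (hA : ∀ᶠ z' in 𝓝 z, ∀ u, A z' u = P z' * fderiv ℝ J z' u)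
    (hJ : ∀ i j, ContDiffAt ℝ 2 (fun z' => J z' i j) z) (hP : DifferentiableAt ℝ P z)
    (hPJ : ∀ᶠ z' in 𝓝 z, P z' * J z' = 1) (u v : Cn k) :
    A.curvature z u v = fderiv ℝ P z u * (1 - J z * P z) * fderiv ℝ J z v
      - fderiv ℝ P z v * (1 - J z * P z) * fderiv ℝ J z u := by
  have hA' (u : Cn k) : (fun z' => A z' u) =ᶠ[𝓝 z] fun z' => P z' * fderiv ℝ J z' u :=
    hA.mono fun _ h => h u
  have hdJ := differentiableAt_fderiv_matrix hJ
  have hdA (u v : Cn k) : fderiv ℝ (fun z' => A z' v) z u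
      = fderiv ℝ P z u * fderiv ℝ J z v + P z * fderiv ℝ (fun z' => fderiv ℝ J z' v) z u := by
    rw [(hA' v).fderiv_eq, fderiv_matrix_mul hP (hdJ v)]
  have hPdJ (u : Cn k) : P z * fderiv ℝ J z u = -(fderiv ℝ P z u * J z) := by
    have hzero : fderiv ℝ (fun z' => P z' * J z') z u = 0 := by
      rw [Filter.EventuallyEq.fderiv_eq hPJ]
      simp
    rw [fderiv_matrix_mul hP (eventually_differentiableAt_matrix hJ).self_of_nhds] at hzero
    exact eq_neg_of_add_eq_zero_right hzero
  have hquad (u v : Cn k) : P z * fderiv ℝ J z u * (P z * fderiv ℝ J z v)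
      = -(fderiv ℝ P z u * (J z * P z) * fderiv ℝ J z v) := by
    simp only [hPdJ u, Matrix.neg_mul, Matrix.mul_assoc]
  rw [ConnForm.curvature_eq
      (fun u => (differentiableAt_matrix_mul hP (hdJ u)).congr_of_eventuallyEq (hA' u)),
    hdA, hdA, fderiv_fderiv_matrix_comm hJ u v, hA.self_of_nhds, hA.self_of_nhds, hquad, hquad]
  simp only [Matrix.mul_sub, Matrix.sub_mul, Matrix.mul_one]
  abel

theorem chernForm_eq {H : Cn k → Matrix (Fin m) (Fin m) ℂ} (hH : DifferentiableAt ℝ H z)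
    (u : Cn k) : chernForm H z u = (H z)⁻¹ * matrixDel H z u := by
  rw [chernForm]
  congr 1
  ext i j
  rw [matrixDel_apply hH, Matrix.of_apply]

theorem chernForm_congr {H K : Cn k → Matrix (Fin m) (Fin m) ℂ} (h : H =ᶠ[𝓝 z] K) :
    chernForm H =ᶠ[𝓝 z] chernForm K := by
  filter_upwards [h.eventuallyEq_nhds] with z' hz'
  have hentry (i j : Fin m) : (fun z'' => H z'' i j) =ᶠ[𝓝 z'] fun z'' => K z'' i j :=
    hz'.fun_comp fun M => M i j
  ext u : 1
  simp only [chernForm, del, hz'.eq_of_nhds, (hentry _ _).fderiv_eq]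

theorem fderiv_eq_mul_chernForm_add {H : Cn k → Matrix (Fin m) (Fin m) ℂ}
    (hH : DifferentiableAt ℝ H z) (hherm : ∀ᶠ z' in 𝓝 z, (H z').IsHermitian)
    (hdet : IsUnit (H z).det) (u : Cn k) :
    fderiv ℝ H z u = H z * chernForm H z u + (chernForm H z u)ᴴ * H z := by
  have hconj (u : Cn k) : (fderiv ℝ H z u)ᴴ = fderiv ℝ H z u := by
    rw [← fderiv_matrix_conjTranspose hH, Filter.EventuallyEq.fderiv_eq hherm]
  rw [chernForm_eq hH, Matrix.mul_nonsing_inv_cancel_left _ _ hdet, Matrix.conjTranspose_mul,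
    Matrix.conjTranspose_nonsing_inv, hherm.self_of_nhds,
    Matrix.nonsing_inv_mul_cancel_right _ _ hdet, matrixDel, Matrix.conjTranspose_smul,
    Matrix.conjTranspose_sub, Matrix.conjTranspose_smul, hconj, hconj]
  simp only [Complex.star_def, map_div₀, map_one, Complex.conj_I, map_ofNat]
  module

end ConnectionForm

section Jacobian

variable {k n : ℕ}

/-- The complex Jacobian matrix of a holomorphic map in the standard bases, so that the differential
of an immersion becomes a holomorphic frame of its tangent bundle. -/
noncomputable def jac (f : Cn k → Cn n) (w : Cn k) : Matrix (Fin n) (Fin k) ℂ :=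
  Matrix.of fun i j => fderiv ℂ f w (basisVec j) i

theorem sum_smul_basisVec (v : Cn k) : ∑ j, v j • basisVec j = v := by
  ext i
  simp [basisVec, Finset.sum_apply, Pi.single_apply]

theorem of_apply_basisVec_mulVec (L : Cn k →L[ℂ] Cn n) (v : Cn k) :
    (Matrix.of fun i j => L (basisVec j) i) *ᵥ v.ofLp = (L v).ofLp := by
  ext i
  conv_rhs => rw [← sum_smul_basisVec v, map_sum]
  simp [Matrix.mulVec, dotProduct, mul_comm]

theorem jac_mulVec (f : Cn k → Cn n) (w v : Cn k) :
    jac f w *ᵥ v.ofLp = (fderiv ℂ f w v).ofLp :=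
  of_apply_basisVec_mulVec _ v

theorem exists_jac_mulVec_eq_iff {f : Cn k → Cn n} {w : Cn k} {x : Cn n} :
    (∃ t, jac f w *ᵥ t = x.ofLp) ↔ ∃ t, x = fderiv ℂ f w t := by
  constructor
  · rintro ⟨t, ht⟩
    exact ⟨WithLp.toLp 2 t, WithLp.ofLp_injective 2 (by rw [← ht, ← jac_mulVec])⟩
  · rintro ⟨t, rfl⟩
    exact ⟨t.ofLp, jac_mulVec f w t⟩

theorem jac_congr {f g : Cn k → Cn n} {w : Cn k} (h : f =ᶠ[𝓝 w] g) : jac f =ᶠ[𝓝 w] jac g := by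
  filter_upwards [h.eventuallyEq_nhds] with w' hw'
  rw [jac, jac, hw'.fderiv_eq]

theorem jac_comp {p : ℕ} {g : Cn n → Cn p} {f : Cn k → Cn n} {w : Cn k}
    (hg : DifferentiableAt ℂ g (f w)) (hf : DifferentiableAt ℂ f w) :
    jac (fun w' => g (f w')) w = jac g (f w) * jac f w := by
  ext i j
  rw [jac, Matrix.of_apply, fderiv_fun_comp w hg hf, ContinuousLinearMap.comp_apply, ← jac_mulVec]
  rfl

theorem jac_mulVec_injective {f : Cn k → Cn n} {w : Cn k}
    (hf : Function.Injective (fderiv ℂ f w)) : Function.Injective (jac f w).mulVec := fun a b hab =>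
  congrArg WithLp.ofLp (hf (a₁ := WithLp.toLp 2 a) (a₂ := WithLp.toLp 2 b)
    (WithLp.ofLp_injective 2 (by simpa only [← jac_mulVec] using hab)))

variable {f : Cn k → Cn n} {w : Cn k}

theorem differentiableAt_fderiv (hf : ContDiffAt ℂ ω f w) :
    DifferentiableAt ℂ (fderiv ℂ f) w :=
  (hf.fderiv_right (m := ω) (by simp)).differentiableAt (by simp)

theorem contDiffAt_jac_apply (hf : ContDiffAt ℂ ω f w) (i : Fin n) (j : Fin k) :
    ContDiffAt ℂ ω (fun w' => jac f w' i j) w :=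
  ((EuclideanSpace.proj i : Cn n →L[ℂ] ℂ).contDiff.contDiffAt).comp w
    ((hf.fderiv_right (m := ω) (by simp)).clm_apply contDiffAt_const)

theorem differentiableAt_jac (hf : ContDiffAt ℂ ω f w) : DifferentiableAt ℂ (jac f) w :=
  differentiableAt_matrix.2 fun i j => (contDiffAt_jac_apply hf i j).differentiableAt (by simp)

theorem fderiv_jac_mulVec (hf : ContDiffAt ℂ ω f w) (u v : Cn k) :
    fderiv ℂ (jac f) w u *ᵥ v.ofLp = (fderiv ℂ (fderiv ℂ f) w u v).ofLp := by
  rw [← of_apply_basisVec_mulVec (fderiv ℂ (fderiv ℂ f) w u) v]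
  congr 1
  ext i j
  rw [fderiv_matrix_apply (differentiableAt_jac hf), Matrix.of_apply]
  have hentry : HasFDerivAt (fun w' => jac f w' i j) _ w :=
    ((EuclideanSpace.proj i : Cn n →L[ℂ] ℂ).hasFDerivAt).comp w
      ((differentiableAt_fderiv hf).hasFDerivAt.clm_apply (hasFDerivAt_const (basisVec j) w))
  rw [hentry.fderiv]
  simp

theorem fderiv_jac_mulVec_comm (hf : ContDiffAt ℂ ω f w) (u v : Cn k) :
    fderiv ℂ (jac f) w u *ᵥ v.ofLp = fderiv ℂ (jac f) w v *ᵥ u.ofLp := by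
  rw [fderiv_jac_mulVec hf, fderiv_jac_mulVec hf, (hf.isSymmSndFDerivAt (by simp)).eq]

theorem fderiv_fderiv_apply (hf : ContDiffAt ℂ ω f w) (u v : Cn k) :
    fderiv ℝ (fun w' => fderiv ℂ f w' v) w u = fderiv ℂ (fderiv ℂ f) w u v := by
  have hdf := differentiableAt_fderiv hf
  rw [fderiv_real_apply (hdf.clm_apply (differentiableAt_const v)),
    fderiv_clm_apply hdf (differentiableAt_const v)]
  simp

end Jacobian

section NormalProjection

variable {m n : Type*} [Fintype m] {H : Matrix m m ℂ}

theorem conjTranspose_mul_mul_eq_zero {B : Matrix m n ℂ} [Finite n] (hH : H.PosDef)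
    (hB : Bᴴ * H * B = 0) : B = 0 := by
  classical
  have := Fintype.ofFinite n
  refine Matrix.ext_of_mulVec_single fun j => ?_
  by_contra hne
  rw [Matrix.zero_mulVec] at hne
  refine (hH.dotProduct_mulVec_pos hne).ne' ?_
  rw [Matrix.star_mulVec, ← Matrix.dotProduct_mulVec, Matrix.mulVec_mulVec, Matrix.mulVec_mulVec,
    hB, Matrix.zero_mulVec, dotProduct_zero]

variable [Fintype n] [DecidableEq n] {J : Matrix m n ℂ}

/-- The coordinates, in the basis formed by the columns of `J`, of the orthogonal projection to
their span with respect to the Hermitian form `H`; meaningful when the Gram matrix `Jᴴ * H * J` is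
invertible. -/
noncomputable def projCoord (H : Matrix m m ℂ) (J : Matrix m n ℂ) : Matrix n m ℂ :=
  (Jᴴ * H * J)⁻¹ * (Jᴴ * H)

/-- The projection to the orthogonal complement of the columns of `J` with respect to the Hermitian
form `H`. -/
noncomputable def normalProj [DecidableEq m] (H : Matrix m m ℂ) (J : Matrix m n ℂ) :
    Matrix m m ℂ :=
  1 - J * projCoord H J

theorem mul_projCoord (hdet : IsUnit (Jᴴ * H * J).det) :
    Jᴴ * H * J * projCoord H J = Jᴴ * H :=
  Matrix.mul_nonsing_inv_cancel_left _ _ hdet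

theorem projCoord_mul_self (hdet : IsUnit (Jᴴ * H * J).det) : projCoord H J * J = 1 := by
  rw [projCoord, Matrix.mul_assoc, Matrix.nonsing_inv_mul _ hdet]

variable [DecidableEq m]

theorem normalProj_mul_self (hdet : IsUnit (Jᴴ * H * J).det) : normalProj H J * J = 0 := by
  rw [normalProj, Matrix.sub_mul, Matrix.mul_assoc, projCoord_mul_self hdet, Matrix.one_mul,
    Matrix.mul_one, sub_self]

theorem projCoord_mul_normalProj (hdet : IsUnit (Jᴴ * H * J).det) :
    projCoord H J * normalProj H J = 0 := by
  rw [normalProj, Matrix.mul_sub, ← Matrix.mul_assoc, projCoord_mul_self hdet, Matrix.one_mul,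
    Matrix.mul_one, sub_self]

theorem conjTranspose_normalProj_mul_mul (hdet : IsUnit (Jᴴ * H * J).det) :
    (normalProj H J)ᴴ * H * normalProj H J = H * normalProj H J := by
  have horth : Jᴴ * (H * normalProj H J) = 0 := by
    rw [← Matrix.mul_assoc, ← mul_projCoord hdet, Matrix.mul_assoc, projCoord_mul_normalProj hdet,
      Matrix.mul_zero]
  conv_lhs => rw [normalProj, Matrix.conjTranspose_sub, Matrix.conjTranspose_one,
    Matrix.conjTranspose_mul, ← normalProj]
  rw [Matrix.mul_assoc, Matrix.sub_mul, Matrix.mul_assoc, horth, Matrix.mul_zero, Matrix.one_mul,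
    sub_zero]

theorem posSemidef_mul_normalProj (hH : H.PosSemidef) (hdet : IsUnit (Jᴴ * H * J).det) :
    (H * normalProj H J).PosSemidef :=
  conjTranspose_normalProj_mul_mul hdet ▸ hH.conjTranspose_mul_mul_same _

theorem normalProj_mulVec_eq_zero_iff (hdet : IsUnit (Jᴴ * H * J).det) {x : m → ℂ} :
    normalProj H J *ᵥ x = 0 ↔ ∃ t, J *ᵥ t = x := by
  constructor
  · intro hx
    rw [normalProj, Matrix.sub_mulVec, Matrix.one_mulVec, sub_eq_zero] at hx
    exact ⟨projCoord H J *ᵥ x, by rw [Matrix.mulVec_mulVec, ← hx]⟩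
  · rintro ⟨t, rfl⟩
    rw [Matrix.mulVec_mulVec, normalProj_mul_self hdet, Matrix.zero_mulVec]

theorem normalProj_mul_eq_zero {p : Type*} [Finite p] {B : Matrix m p ℂ}
    (hH : H.PosDef) (hdet : IsUnit (Jᴴ * H * J).det)
    (hB : Bᴴ * (H * normalProj H J) * B = 0) :
    normalProj H J * B = 0 := by
  refine conjTranspose_mul_mul_eq_zero hH ?_
  rw [← hB, ← conjTranspose_normalProj_mul_mul hdet, Matrix.conjTranspose_mul]
  simp only [Matrix.mul_assoc]

end NormalProjection

section Subbundle

variable {k m n : ℕ} {H : Matrix (Fin n) (Fin n) ℂ} {J : Cn k → Matrix (Fin n) (Fin m) ℂ}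
  {z : Cn k}

theorem chernForm_subbundle (hJ : DifferentiableAt ℂ J z) (u : Cn k) :
    chernForm (fun z' => (J z')ᴴ * H * J z') z u = projCoord H (J z) * fderiv ℂ J z u := by
  have hJ' := differentiableAt_real_matrix hJ
  have hconst : DifferentiableAt ℝ (fun _ : Cn k => H) z := differentiableAt_const H
  rw [chernForm_eq (differentiableAt_matrix_mul
      (differentiableAt_matrix_mul (differentiableAt_matrix_conjTranspose hJ') hconst) hJ'),
    matrixDel_conjTranspose_mul_mul hJ hconst, matrixDel_const, Matrix.zero_mul, zero_add,
    projCoord]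
  simp only [Matrix.mul_assoc]

theorem differentiableAt_projCoord (hJ : DifferentiableAt ℝ J z)
    (hdet : IsUnit ((J z)ᴴ * H * J z).det) :
    DifferentiableAt ℝ (fun z' => projCoord H (J z')) z := by
  have hJH : DifferentiableAt ℝ (fun z' => (J z')ᴴ * H) z :=
    differentiableAt_matrix_mul (differentiableAt_matrix_conjTranspose hJ)
      (differentiableAt_const H)
  exact differentiableAt_matrix_mul
    (differentiableAt_matrix_inv (differentiableAt_matrix_mul hJH hJ) hdet) hJH

theorem eventually_isUnit_det {M : Cn k → Matrix (Fin m) (Fin m) ℂ} (hM : DifferentiableAt ℝ M z)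
    (hdet : IsUnit (M z).det) : ∀ᶠ z' in 𝓝 z, IsUnit (M z').det := by
  simp only [isUnit_iff_ne_zero] at hdet ⊢
  exact (differentiableAt_matrix_det hM).continuousAt.eventually_ne hdet

/-- Differentiate `Jᴴ H J * projCoord H J = Jᴴ H`. -/
theorem mul_fderiv_projCoord_mul_normalProj (hJ : DifferentiableAt ℝ J z)
    (hdet : IsUnit ((J z)ᴴ * H * J z).det) (u : Cn k) :
    (J z)ᴴ * H * J z * fderiv ℝ (fun z' => projCoord H (J z')) z u * normalProj H (J z)
      = (fderiv ℝ J z u)ᴴ * (H * normalProj H (J z)) := by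
  have hJc := differentiableAt_matrix_conjTranspose hJ
  have hconst : DifferentiableAt ℝ (fun _ : Cn k => H) z := differentiableAt_const H
  have hh := differentiableAt_matrix_mul (differentiableAt_matrix_mul hJc hconst) hJ
  have hev : (fun z' => (J z')ᴴ * H * J z' * projCoord H (J z')) =ᶠ[𝓝 z] fun z' => (J z')ᴴ * H :=
    (eventually_isUnit_det hh hdet).mono fun z' hz' => mul_projCoord hz'
  have hder := congrArg (fun L : Cn k →L[ℝ] Matrix (Fin m) (Fin n) ℂ => L u) hev.fderiv_eq
  simp only [fderiv_matrix_mul hh (differentiableAt_projCoord hJ hdet),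
    fderiv_matrix_mul hJc hconst, fderiv_matrix_conjTranspose hJ, fderiv_fun_const, Pi.zero_apply,
    zero_apply, Matrix.mul_zero, add_zero] at hder
  rw [← Matrix.mul_assoc, ← hder, Matrix.add_mul, Matrix.mul_assoc _ (projCoord H (J z)),
    projCoord_mul_normalProj hdet, Matrix.mul_zero, zero_add]

/-- The Gauss equation: `H * normalProj H J` is the metric of the quotient bundle, extended by zero,
and `normalProj H J * dJ` is the second fundamental form. -/
theorem mul_curvature_subbundle (hJ : ∀ i j, ContDiffAt ℂ ω (fun z' => J z' i j) z)
    (hdet : IsUnit ((J z)ᴴ * H * J z).det) (u v : Cn k) :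
    (J z)ᴴ * H * J z * (chernForm fun z' => (J z')ᴴ * H * J z').curvature z u v
      = (fderiv ℂ J z u)ᴴ * (H * normalProj H (J z)) * fderiv ℂ J z v
        - (fderiv ℂ J z v)ᴴ * (H * normalProj H (J z)) * fderiv ℂ J z u := by
  have hJev : ∀ᶠ z' in 𝓝 z, DifferentiableAt ℂ J z' := by
    simp only [differentiableAt_matrix, Filter.eventually_all]
    exact fun i j => ((hJ i j).eventually (by simp)).mono fun _ h => h.differentiableAt (by simp)
  have hJz := differentiableAt_real_matrix hJev.self_of_nhds
  have hh := differentiableAt_matrix_mul (differentiableAt_matrix_mul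
    (differentiableAt_matrix_conjTranspose hJz) (differentiableAt_const H)) hJz
  have hA : ∀ᶠ z' in 𝓝 z, ∀ u, chernForm (fun z' => (J z')ᴴ * H * J z') z' u
      = projCoord H (J z') * fderiv ℝ J z' u :=
    hJev.mono fun z' h u => by rw [chernForm_subbundle h, fderiv_real_matrix_apply h]
  rw [ConnForm.curvature_of_eq_mul_fderiv hA
      (fun i j => ((hJ i j).restrict_scalars ℝ).of_le le_top) (differentiableAt_projCoord hJz hdet)
      ((eventually_isUnit_det hh hdet).mono fun _ h => projCoord_mul_self h),
    Matrix.mul_sub, ← normalProj]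
  simp only [← Matrix.mul_assoc ((J z)ᴴ * H * J z), mul_fderiv_projCoord_mul_normalProj hJz hdet,
    fderiv_real_matrix_apply hJev.self_of_nhds]

theorem mul_curvatureMixed_subbundle (hJ : ∀ i j, ContDiffAt ℂ ω (fun z' => J z' i j) z)
    (hdet : IsUnit ((J z)ᴴ * H * J z).det) (u v : Cn k) :
    (J z)ᴴ * H * J z * (chernForm fun z' => (J z')ᴴ * H * J z').curvatureMixed z u v
      = -((fderiv ℂ J z v)ᴴ * (H * normalProj H (J z)) * fderiv ℂ J z u) := by
  simp only [ConnForm.curvatureMixed, Matrix.mul_smul, Matrix.mul_add, Matrix.mul_sub,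
    mul_curvature_subbundle hJ hdet, map_smul, Matrix.conjTranspose_smul, Matrix.smul_mul, smul_sub,
    smul_smul, Complex.star_def, Complex.conj_I, mul_neg, Complex.I_mul_I, neg_neg]
  module

theorem curvature_subbundle_eq_zero_iff (hH : H.PosDef)
    (hJ : ∀ i j, ContDiffAt ℂ ω (fun z' => J z' i j) z) (hdet : IsUnit ((J z)ᴴ * H * J z).det) :
    (∀ u v, (chernForm fun z' => (J z')ᴴ * H * J z').curvature z u v = 0) ↔
      ∀ u, normalProj H (J z) * fderiv ℂ J z u = 0 := by
  constructor
  · intro hcurv u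
    refine normalProj_mul_eq_zero hH hdet (neg_eq_zero.1 ?_)
    rw [← mul_curvatureMixed_subbundle hJ hdet]
    simp [ConnForm.curvatureMixed, hcurv]
  · intro hsff u v
    rw [← Matrix.nonsing_inv_mul_cancel_left _ (ConnForm.curvature _ z u v) hdet,
      mul_curvature_subbundle hJ hdet]
    simp only [Matrix.mul_assoc, hsff, Matrix.mul_zero, sub_self]

end Subbundle
section Positivity

variable {k m n : Type*}

open scoped MatrixOrder in
theorem posDef_map_ofReal [Finite n] {A : Matrix n n ℝ} (hA : A.PosDef) :
    (A.map Complex.ofReal).PosDef := by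
  classical
  have := Fintype.ofFinite n
  obtain ⟨B, hB, rfl⟩ :=
    CStarAlgebra.isStrictlyPositive_iff_eq_star_mul_self.1 hA.isStrictlyPositive
  have hB' : IsUnit (B.map Complex.ofReal) := hB.map Complex.ofRealHom.mapMatrix
  have hmap : (star B * B).map Complex.ofReal = (B.map Complex.ofReal)ᴴ * B.map Complex.ofReal := by
    ext i j
    simp [Matrix.mul_apply]
  rw [hmap]
  exact Matrix.PosDef.conjTranspose_mul_self _ (Matrix.mulVec_injective_of_isUnit hB')

variable [Fintype k] [Fintype m] [Fintype n]

open scoped MatrixOrder in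
theorem trace_mul_nonneg {A B : Matrix n n ℂ} (hA : A.PosSemidef)
    (hB : B.PosSemidef) : 0 ≤ (A * B).trace := by
  classical
  obtain ⟨C, rfl⟩ := CStarAlgebra.nonneg_iff_eq_star_mul_self.1 hA.nonneg
  rw [Matrix.star_eq_conjTranspose, Matrix.mul_assoc, Matrix.trace_mul_comm]
  exact (hB.mul_mul_conjTranspose_same C).trace_nonneg

theorem sum_sum_conjTranspose_mul_mul (N : Matrix m m ℂ) (B C : Matrix m n ℂ) (a b : n → ℂ) :
    ∑ i, ∑ j, (Cᴴ * N * B) j i * a i * conj (b j) = star (C *ᵥ b) ⬝ᵥ (N *ᵥ (B *ᵥ a)) := by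
  rw [Matrix.star_mulVec, ← Matrix.dotProduct_mulVec, Matrix.mulVec_mulVec, Matrix.mulVec_mulVec,
    Finset.sum_comm]
  simp only [dotProduct, Matrix.mulVec, Finset.mul_sum, Pi.star_apply, Complex.star_def,
    Matrix.mul_assoc]
  exact Finset.sum_congr rfl fun j _ => Finset.sum_congr rfl fun i _ => by ring

/-- The sum is the value of `N` on the vector `∑ i, B i *ᵥ u i`. -/
theorem sum_conjTranspose_mul_mul_nonneg {N : Matrix m m ℂ} (hN : N.PosSemidef)
    (B : k → Matrix m n ℂ) (u : k → n → ℂ) :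
    0 ≤ ∑ i, ∑ j, ∑ a, ∑ b, ((B j)ᴴ * N * B i) b a * u i a * conj (u j b) := by
  simp only [sum_sum_conjTranspose_mul_mul]
  have h := hN.dotProduct_mulVec_nonneg (∑ i, B i *ᵥ u i)
  rw [star_sum, Matrix.mulVec_sum, sum_dotProduct] at h
  simp only [dotProduct_sum] at h
  rwa [Finset.sum_comm] at h

/-- The sum is the trace of `A` times the pull-back of `N` by `∑ i, u i • B i`. -/
theorem sum_trace_mul_conjTranspose_mul_mul_nonneg {N : Matrix m m ℂ}
    (hN : N.PosSemidef) {A : Matrix n n ℂ} (hA : A.PosSemidef) (B : k → Matrix m n ℂ) (u : k → ℂ) :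
    0 ≤ ∑ i, ∑ j, (A * ((B j)ᴴ * N * B i)).trace * u i * conj (u j) := by
  refine (trace_mul_nonneg hA (hN.conjTranspose_mul_mul_same (∑ i, u i • B i))).trans_eq ?_
  simp only [Matrix.conjTranspose_sum, Matrix.conjTranspose_smul, Finset.mul_sum,
    Matrix.trace_sum, Matrix.sum_mul, Matrix.mul_sum, Matrix.smul_mul,
    Matrix.mul_smul, Matrix.trace_smul, smul_eq_mul, Complex.star_def]
  exact Finset.sum_congr rfl fun i _ => Finset.sum_congr rfl fun j _ => by ring

theorem NakanoNonpos.bisectionalNonpos {s : ℕ} {S : Type*} [TopologicalSpace S]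
    [ChartedSpace (Cn s) S] {g : TangentPairing s S} (hg : NakanoNonpos g) :
    BisectionalNonpos g := by
  intro e he z hz u v
  refine le_of_eq_of_le ?_ (hg e he z hz fun i a => u i * v a)
  refine Finset.sum_congr rfl fun i _ => Finset.sum_congr rfl fun j _ => ?_
  refine Finset.sum_congr rfl fun a _ => Finset.sum_congr rfl fun b _ => ?_
  rw [map_mul]
  ring

end Positivity

section FlatImmersion

variable {r s : ℕ} {S : Type*} [TopologicalSpace S] [ChartedSpace (Cn s) S]

/-- Near the point with coordinates `w` in the chart `d`, the metric `g` is induced from the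
constant Hermitian metric `H` of `ℂʳ` by the holomorphic immersion `f`. -/
structure IsFlatImmersionAt (g : TangentPairing s S) (d : OpenPartialHomeomorph S (Cn s))
    (w : Cn s) (H : Matrix (Fin r) (Fin r) ℂ) (f : Cn s → Cn r) : Prop where
  posDef : H.PosDef
  contDiffAt : ContDiffAt ℂ ω f w
  fderiv_injective : Function.Injective (fderiv ℂ f w)
  metricMatrix_eq : metricMatrix g d =ᶠ[𝓝 w] fun w' => (jac f w')ᴴ * H * jac f w'

namespace IsFlatImmersionAt

variable {g : TangentPairing s S} {d : OpenPartialHomeomorph S (Cn s)} {w : Cn s}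
  {H : Matrix (Fin r) (Fin r) ℂ} {f : Cn s → Cn r}

theorem posDef_metricMatrix (h : IsFlatImmersionAt g d w H f) : (metricMatrix g d w).PosDef := by
  rw [h.metricMatrix_eq.eq_of_nhds]
  exact h.posDef.conjTranspose_mul_mul_same (jac_mulVec_injective h.fderiv_injective)

theorem isUnit_det (h : IsFlatImmersionAt g d w H f) :
    IsUnit ((jac f w)ᴴ * H * jac f w).det := by
  have hunit := h.posDef_metricMatrix.isUnit
  rwa [h.metricMatrix_eq.eq_of_nhds, Matrix.isUnit_iff_isUnit_det] at hunit

theorem curvature_eq (h : IsFlatImmersionAt g d w H f) :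
    (chernConn g d).curvature w
      = (chernForm fun w' => (jac f w')ᴴ * H * jac f w').curvature w :=
  ConnForm.curvature_congr (chernForm_congr h.metricMatrix_eq)

/-- The metric of the normal bundle of the image of `f`, extended by zero to tangent vectors. -/
theorem posSemidef_normalMetric (h : IsFlatImmersionAt g d w H f) :
    (H * normalProj H (jac f w)).PosSemidef :=
  posSemidef_mul_normalProj h.posDef.posSemidef h.isUnit_det

theorem metricMatrix_mul_curvatureMixed (h : IsFlatImmersionAt g d w H f) (u v : Cn s) :
    metricMatrix g d w * (chernConn g d).curvatureMixed w u v
      = -((fderiv ℂ (jac f) w v)ᴴ * (H * normalProj H (jac f w)) * fderiv ℂ (jac f) w u) := by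
  rw [← mul_curvatureMixed_subbundle (contDiffAt_jac_apply h.contDiffAt) h.isUnit_det,
    h.metricMatrix_eq.eq_of_nhds, ConnForm.curvatureMixed, h.curvature_eq, ConnForm.curvatureMixed]

theorem sum_riemann_nonpos (h : IsFlatImmersionAt g d w H f) (u : Fin s → Fin s → ℂ) :
    ∑ i, ∑ j, ∑ a, ∑ b, riemann g d w i j a b * u i a * conj (u j b) ≤ 0 := by
  simp only [riemann, h.metricMatrix_mul_curvatureMixed, Matrix.neg_apply, neg_mul,
    Finset.sum_neg_distrib]
  exact neg_nonpos.2 (sum_conjTranspose_mul_mul_nonneg h.posSemidef_normalMetric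
    (fun i => fderiv ℂ (jac f) w (basisVec i)) u)

theorem sum_ricci_nonpos (h : IsFlatImmersionAt g d w H f) (u : Fin s → ℂ) :
    ∑ i, ∑ j, ricci g d w i j * u i * conj (u j) ≤ 0 := by
  have hdet := (Matrix.isUnit_iff_isUnit_det _).1 h.posDef_metricMatrix.isUnit
  have hmixed (u v : Cn s) : (chernConn g d).curvatureMixed w u v
      = (metricMatrix g d w)⁻¹ * -((fderiv ℂ (jac f) w v)ᴴ * (H * normalProj H (jac f w))
        * fderiv ℂ (jac f) w u) := by
    rw [← h.metricMatrix_mul_curvatureMixed, Matrix.nonsing_inv_mul_cancel_left _ _ hdet]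
  simp only [ricci, hmixed, Matrix.mul_neg, Matrix.trace_neg, neg_mul,
    Finset.sum_neg_distrib]
  exact neg_nonpos.2 (sum_trace_mul_conjTranspose_mul_mul_nonneg h.posSemidef_normalMetric
    h.posDef_metricMatrix.inv.posSemidef (fun i => fderiv ℂ (jac f) w (basisVec i)) u)

theorem curvature_eq_zero_iff (h : IsFlatImmersionAt g d w H f) :
    (∀ u v, (chernConn g d).curvature w u v = 0) ↔
      ∀ u v : Cn s, ∃ t, fderiv ℂ (fderiv ℂ f) w u v = fderiv ℂ f w t := by
  have hmulVec (u v : Cn s) : (normalProj H (jac f w) * fderiv ℂ (jac f) w u) *ᵥ v.ofLp = 0 ↔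
      ∃ t, fderiv ℂ (fderiv ℂ f) w u v = fderiv ℂ f w t := by
    rw [← Matrix.mulVec_mulVec, fderiv_jac_mulVec h.contDiffAt,
      normalProj_mulVec_eq_zero_iff h.isUnit_det, exists_jac_mulVec_eq_iff]
  rw [h.curvature_eq, curvature_subbundle_eq_zero_iff h.posDef (contDiffAt_jac_apply h.contDiffAt)
    h.isUnit_det]
  simp only [← hmulVec, Matrix.ext_iff_mulVec, Matrix.zero_mulVec]
  exact forall_congr' fun u => (WithLp.equiv 2 (Fin s → ℂ)).symm.forall_congr_left

end IsFlatImmersionAt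

end FlatImmersion

section Charts

open Manifold

section

variable {𝕜 : Type*} [NontriviallyNormedField 𝕜]
  {E : Type*} [NormedAddCommGroup E] [NormedSpace 𝕜 E]
  {E' : Type*} [NormedAddCommGroup E'] [NormedSpace 𝕜 E']
  {M : Type*} [TopologicalSpace M] [ChartedSpace E M]
  {M' : Type*} [TopologicalSpace M'] [ChartedSpace E' M'] {k : ℕ∞ω}

theorem mdifferentiable_of_mem_maximalAtlas {e : OpenPartialHomeomorph M E}
    (he : e ∈ IsManifold.maximalAtlas 𝓘(𝕜, E) k M) (hk : k ≠ 0) :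
    e.MDifferentiable 𝓘(𝕜, E) 𝓘(𝕜, E) :=
  ⟨(contMDiffOn_of_mem_maximalAtlas he).mdifferentiableOn hk,
    (contMDiffOn_symm_of_mem_maximalAtlas he).mdifferentiableOn hk⟩

theorem mfderiv_injective_of_isImmersionAt [IsManifold 𝓘(𝕜, E) 1 M] {f : M → M'} {x : M}
    (h : IsImmersionAt 𝓘(𝕜, E) 𝓘(𝕜, E') k f x) (hk : k ≠ 0) :
    Function.Injective (mfderiv 𝓘(𝕜, E) 𝓘(𝕜, E') f x) := by
  have hd := mdifferentiable_of_mem_maximalAtlas h.domChart_mem_maximalAtlas hk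
  have he := mdifferentiable_of_mem_maximalAtlas h.codChart_mem_maximalAtlas hk
  have hx := h.mem_domChart_source
  let incl : E →L[𝕜] E' := h.equiv.toContinuousLinearMap ∘L .inl 𝕜 E h.complement
  have hincl : Function.Injective incl := h.equiv.injective.comp (Prod.mk_left_injective 0)
  have hf : h.codChart ∘ f =ᶠ[𝓝 x] incl ∘ h.domChart := by
    filter_upwards [h.domChart.open_source.mem_nhds hx] with y hy
    have hwritten := h.writtenInCharts (show h.domChart y ∈ _ by simp [hy])
    simpa [hy, incl] using hwritten
  have hderiv := hf.mfderiv_eq (I := 𝓘(𝕜, E)) (I' := 𝓘(𝕜, E'))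
  rw [mfderiv_comp x (he.mdifferentiableAt h.mem_codChart_source)
      (h.contMDiffAt.mdifferentiableAt hk),
    mfderiv_comp x incl.mdifferentiableAt (hd.mdifferentiableAt hx),
    incl.mfderiv_eq] at hderiv
  refine Function.Injective.of_comp (f := mfderiv 𝓘(𝕜, E') 𝓘(𝕜, E') h.codChart (f x)) ?_
  rw [← ContinuousLinearMap.coe_comp, hderiv]
  exact hincl.comp (hd.mfderiv_injective hx)

end

variable {n s : ℕ} {X : Type*} [TopologicalSpace X] {S : Type*} [TopologicalSpace S]
  {ι : S → X} {d : OpenPartialHomeomorph S (Cn s)} {e e' : OpenPartialHomeomorph X (Cn n)}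
  {w : Cn s}

theorem inCharts_mem_target (hwe : ι (d.symm w) ∈ e.source) : inCharts ι d e w ∈ e.target :=
  e.map_source hwe

theorem symm_inCharts (hwe : ι (d.symm w) ∈ e.source) : e.symm (inCharts ι d e w) = ι (d.symm w) :=
  e.left_inv hwe

theorem eventually_mem_charts (hι : Continuous ι) (hw : w ∈ d.target)
    (hwe : ι (d.symm w) ∈ e.source) :
    ∀ᶠ w' in 𝓝 w, w' ∈ d.target ∧ ι (d.symm w') ∈ e.source :=
  Filter.Eventually.and (d.open_target.mem_nhds hw)
    ((hι.continuousAt.comp (d.continuousAt_symm hw)).eventually (e.open_source.mem_nhds hwe))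

theorem inCharts_eventuallyEq_comp (hι : Continuous ι) (hw : w ∈ d.target)
    (hwe : ι (d.symm w) ∈ e.source) :
    inCharts ι d e' =ᶠ[𝓝 w] fun w' => inCharts id e e' (inCharts ι d e w') := by
  filter_upwards [eventually_mem_charts hι hw hwe] with w' hw'
  simp only [inCharts, id, e.left_inv hw'.2]

variable [ChartedSpace (Cn n) X] [ChartedSpace (Cn s) S]

theorem contDiffAt_inCharts (hι : ContMDiff 𝓘(ℂ, Cn s) 𝓘(ℂ, Cn n) ω ι) (hd : d ∈ holCharts s S)
    (he : e ∈ holCharts n X) (hw : w ∈ d.target) (hwe : ι (d.symm w) ∈ e.source) :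
    ContDiffAt ℂ ω (inCharts ι d e) w :=
  contMDiffAt_iff_contDiffAt.1 <| (contMDiffAt_of_mem_maximalAtlas he hwe).comp w <|
    (hι (d.symm w)).comp w (contMDiffAt_symm_of_mem_maximalAtlas hd hw)

theorem fderiv_inCharts (hι : ContMDiff 𝓘(ℂ, Cn s) 𝓘(ℂ, Cn n) ω ι) (hd : d ∈ holCharts s S)
    (he : e ∈ holCharts n X) (hw : w ∈ d.target) (hwe : ι (d.symm w) ∈ e.source) :
    fderiv ℂ (inCharts ι d e) w =
      mfderiv 𝓘(ℂ, Cn n) 𝓘(ℂ, Cn n) e (ι (d.symm w)) ∘L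
        mfderiv 𝓘(ℂ, Cn s) 𝓘(ℂ, Cn n) ι (d.symm w) ∘L
          mfderiv 𝓘(ℂ, Cn s) 𝓘(ℂ, Cn s) d.symm w := by
  have hd' := (mdifferentiable_of_mem_maximalAtlas hd (by simp)).mdifferentiableAt_symm hw
  have he' := (mdifferentiable_of_mem_maximalAtlas he (by simp)).mdifferentiableAt hwe
  have hι' := (hι (d.symm w)).mdifferentiableAt (by simp)
  rw [← mfderiv_eq_fderiv]
  exact (he'.hasMFDerivAt.comp w (hι'.hasMFDerivAt.comp w hd'.hasMFDerivAt)).mfderiv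

theorem fderiv_inCharts_injective [IsManifold 𝓘(ℂ, Cn n) ω X] [IsManifold 𝓘(ℂ, Cn s) ω S]
    (hι : IsImmersion 𝓘(ℂ, Cn s) 𝓘(ℂ, Cn n) ω ι) (hd : d ∈ holCharts s S)
    (he : e ∈ holCharts n X) (hw : w ∈ d.target) (hwe : ι (d.symm w) ∈ e.source) :
    Function.Injective (fderiv ℂ (inCharts ι d e) w) := by
  have : IsManifold 𝓘(ℂ, Cn n) 1 X := .of_le (n := ω) le_top
  have : IsManifold 𝓘(ℂ, Cn s) 1 S := .of_le (n := ω) le_top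
  have hd' := mdifferentiable_of_mem_maximalAtlas hd (by simp)
  have he' := mdifferentiable_of_mem_maximalAtlas he (by simp)
  rw [fderiv_inCharts hι.contMDiff hd he hw hwe]
  exact (he'.mfderiv_injective hwe).comp
    ((mfderiv_injective_of_isImmersionAt (hι.isImmersionAt _) (by simp)).comp
      (hd'.symm.mfderiv_injective (x := w) hw))

omit [ChartedSpace (Cn s) S] in
theorem contDiffAt_transition (he : e ∈ holCharts n X) (he' : e' ∈ holCharts n X)
    (hwe : ι (d.symm w) ∈ e.source) (hwe' : ι (d.symm w) ∈ e'.source) :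
    ContDiffAt ℂ ω (inCharts id e e') (inCharts ι d e w) :=
  contDiffAt_inCharts contMDiff_id he he' (inCharts_mem_target hwe) (by rwa [symm_inCharts hwe])

theorem jac_inCharts_eq_mul (hι : ContMDiff 𝓘(ℂ, Cn s) 𝓘(ℂ, Cn n) ω ι)
    (hd : d ∈ holCharts s S) (he : e ∈ holCharts n X) (he' : e' ∈ holCharts n X)
    (hw : w ∈ d.target) (hwe : ι (d.symm w) ∈ e.source) (hwe' : ι (d.symm w) ∈ e'.source) :
    jac (inCharts ι d e') w
      = jac (inCharts id e e') (inCharts ι d e w) * jac (inCharts ι d e) w := by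
  rw [(jac_congr (inCharts_eventuallyEq_comp hι.continuous hw hwe)).eq_of_nhds,
    jac_comp ((contDiffAt_transition he he' hwe hwe').differentiableAt (by simp))
      ((contDiffAt_inCharts hι hd he hw hwe).differentiableAt (by simp))]

end Charts

namespace SpecialChart

variable {r : ℕ} {X : Type*} [TopologicalSpace X] [ChartedSpace (Cn r) X]

/-- The matrix `Im τ` as a function of the special coordinates, with complex entries. -/
noncomputable def imHessian (c : SpecialChart r X) (z : Cn r) : Matrix (Fin r) (Fin r) ℂ :=
  ((hessian c.F z).map Complex.im).map Complex.ofReal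

variable (c : SpecialChart r X) {z : Cn r}

theorem posDef_imHessian (hz : z ∈ c.a.target) : (c.imHessian z).PosDef :=
  posDef_map_ofReal (c.posDef z hz)

theorem contDiffAt_gradient (hz : z ∈ c.a.target) (i : Fin r) :
    ContDiffAt ℂ ∞ (fun z' => gradient c.F z' i) z := by
  have hF : ContDiffAt ℂ ∞ c.F z :=
    (contDiffOn_infty_of_differentiableOn c.a.open_target c.holomorphic).contDiffAt
      (c.a.open_target.mem_nhds hz)
  exact (hF.fderiv_right (m := ∞) (by simp)).clm_apply contDiffAt_const

theorem hasFDerivAt_hessian_apply (hz : z ∈ c.a.target) (i j : Fin r) :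
    HasFDerivAt (fun z' => hessian c.F z' i j)
      ((fderiv ℂ (fderiv ℂ fun z' => gradient c.F z' i) z).flip (basisVec j)) z := by
  have hdiff := ((c.contDiffAt_gradient hz i).fderiv_right (m := ∞) (by simp)).differentiableAt
    (by simp)
  have happly := hdiff.hasFDerivAt.clm_apply (hasFDerivAt_const (basisVec j) z)
  rw [ContinuousLinearMap.comp_zero, zero_add] at happly
  exact happly

theorem differentiableAt_hessian (hz : z ∈ c.a.target) : DifferentiableAt ℂ (hessian c.F) z :=
  differentiableAt_matrix.2 fun i j => (c.hasFDerivAt_hessian_apply hz i j).differentiableAt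

theorem fderiv_hessian_mulVec (hz : z ∈ c.a.target) (u v : Cn r) (i : Fin r) :
    (fderiv ℂ (hessian c.F) z u *ᵥ v.ofLp) i
      = fderiv ℂ (fderiv ℂ fun z' => gradient c.F z' i) z u v := by
  conv_rhs => rw [← sum_smul_basisVec v, map_sum]
  simp only [Matrix.mulVec, dotProduct, fderiv_matrix_apply (c.differentiableAt_hessian hz),
    (c.hasFDerivAt_hessian_apply hz i _).fderiv, ContinuousLinearMap.flip_apply, map_smul,
    smul_eq_mul, mul_comm]

theorem hasFDerivAt_imHessian_apply (hz : z ∈ c.a.target) (i j : Fin r) :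
    HasFDerivAt (fun z' => c.imHessian z' i j)
      ((Complex.ofRealCLM ∘L Complex.imCLM) ∘L
        (fderiv ℂ (fun z' => hessian c.F z' i j) z).restrictScalars ℝ) z :=
  (Complex.ofRealCLM ∘L Complex.imCLM).hasFDerivAt.comp z
    ((differentiableAt_matrix.1 (c.differentiableAt_hessian hz) i j).hasFDerivAt.restrictScalars ℝ)

theorem differentiableAt_imHessian (hz : z ∈ c.a.target) : DifferentiableAt ℝ c.imHessian z :=
  differentiableAt_matrix.2 fun i j => (c.hasFDerivAt_imHessian_apply hz i j).differentiableAt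

theorem matrixDel_imHessian (hz : z ∈ c.a.target) (u : Cn r) :
    matrixDel c.imHessian z u = (-Complex.I / 2) • fderiv ℂ (hessian c.F) z u := by
  ext i j
  rw [matrixDel_apply (c.differentiableAt_imHessian hz), Matrix.smul_apply,
    fderiv_matrix_apply (c.differentiableAt_hessian hz), del,
    (c.hasFDerivAt_imHessian_apply hz i j).fderiv]
  generalize fderiv ℂ (fun z' => hessian c.F z' i j) z = L
  apply Complex.ext <;> simp <;> ring

theorem matrixDel_imHessian_mulVec_comm (hz : z ∈ c.a.target) (u v : Cn r) :
    matrixDel c.imHessian z u *ᵥ v.ofLp = matrixDel c.imHessian z v *ᵥ u.ofLp := by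
  rw [c.matrixDel_imHessian hz, c.matrixDel_imHessian hz, Matrix.smul_mulVec, Matrix.smul_mulVec]
  congr 1
  ext i
  rw [c.fderiv_hessian_mulVec hz, c.fderiv_hessian_mulVec hz,
    ((contDiffAt_infty.1 (c.contDiffAt_gradient hz i) 2).isSymmSndFDerivAt (by simp)).eq]

end SpecialChart

section InducedMetric

theorem chernForm_conjTranspose_mul_mul {k m n : ℕ} {z : Cn k}
    {J : Cn k → Matrix (Fin m) (Fin n) ℂ} {H : Cn k → Matrix (Fin m) (Fin m) ℂ}
    (hJ : DifferentiableAt ℂ J z) (hH : DifferentiableAt ℝ H z) (v : Cn k) :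
    chernForm (fun z' => (J z')ᴴ * H z' * J z') z v = ((J z)ᴴ * H z * J z)⁻¹ *
      ((J z)ᴴ * (matrixDel H z v * J z + H z * fderiv ℂ J z v)) := by
  have hJ' := differentiableAt_real_matrix hJ
  rw [chernForm_eq (differentiableAt_matrix_mul (differentiableAt_matrix_mul
      (differentiableAt_matrix_conjTranspose hJ') hH) hJ'), matrixDel_conjTranspose_mul_mul hJ hH]

theorem act_chernForm_jac_comm {k n : ℕ} {f : Cn k → Cn n} {w : Cn k}
    {H : Cn n → Matrix (Fin n) (Fin n) ℂ} (hf : ContDiffAt ℂ ω f w)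
    (hH : DifferentiableAt ℝ H (f w))
    (hcomm : ∀ u v, matrixDel H (f w) u *ᵥ v.ofLp = matrixDel H (f w) v *ᵥ u.ofLp) (u v : Cn k) :
    act (chernForm (fun w' => (jac f w')ᴴ * H (f w') * jac f w') w u) v
      = act (chernForm (fun w' => (jac f w')ᴴ * H (f w') * jac f w') w v) u := by
  have hf' := hf.differentiableAt (by simp)
  have hHf := differentiableAt_matrix_comp hH (hf'.restrictScalars ℝ)
  simp only [act, chernForm_conjTranspose_mul_mul (differentiableAt_jac hf) hHf,
    matrixDel_comp hH hf', ← Matrix.mulVec_mulVec, Matrix.add_mulVec, jac_mulVec]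
  rw [hcomm, fderiv_jac_mulVec_comm hf]

variable {r s : ℕ} {X : Type*} [TopologicalSpace X] [ChartedSpace (Cn r) X]
  {S : Type*} [TopologicalSpace S] [ChartedSpace (Cn s) S]
  {K : SpecialKahlerStructure r X} {c : SpecialChart r X}
  {ι : S → X} {d : OpenPartialHomeomorph S (Cn s)} {w : Cn s}

theorem metricMatrix_inducedMetric (hι : ContMDiff 𝓘(ℂ, Cn s) 𝓘(ℂ, Cn r) ω ι)
    (hd : d ∈ holCharts s S) (hc : c ∈ K.charts) (hw : w ∈ d.target)
    (hwc : ι (d.symm w) ∈ c.a.source) :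
    metricMatrix (inducedMetric (s := s) K.metric ι) d w
      = (jac (inCharts ι d c.a) w)ᴴ * c.imHessian (inCharts ι d c.a w)
        * jac (inCharts ι d c.a) w := by
  have hpos := (c.posDef_imHessian (inCharts_mem_target hwc)).isHermitian
  have hda (j : Fin s) (i : Fin r) : c.da (ι (d.symm w))
      (mfderiv 𝓘(ℂ, Cn s) 𝓘(ℂ, Cn r) ι (d.symm w) (coordField d w j)) i
        = jac (inCharts ι d c.a) w i j :=
    congrArg (fun L : Cn s →L[ℂ] Cn r => L (basisVec j) i)
      (fderiv_inCharts hι hd c.a_mem hw hwc).symm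
  have hH (i j : Fin r) : ((c.periodMatrix (ι (d.symm w)) i j).im : ℂ)
      = c.imHessian (inCharts ι d c.a w) j i := by
    rw [← hpos.apply]
    simp [SpecialChart.imHessian, SpecialChart.periodMatrix, inCharts]
  ext l k
  simp only [metricMatrix, Matrix.of_apply, inducedMetric, K.metric_eq c hc _ hwc, hda, hH,
    Matrix.mul_apply, Matrix.conjTranspose_apply, Finset.sum_mul, Complex.star_def]
  exact Finset.sum_congr rfl fun i _ => Finset.sum_congr rfl fun j _ => by ring

theorem metricMatrix_inducedMetric_eventuallyEq (hι : ContMDiff 𝓘(ℂ, Cn s) 𝓘(ℂ, Cn r) ω ι)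
    (hd : d ∈ holCharts s S) (hc : c ∈ K.charts) (hw : w ∈ d.target)
    (hwc : ι (d.symm w) ∈ c.a.source) :
    metricMatrix (inducedMetric (s := s) K.metric ι) d
      =ᶠ[𝓝 w] fun w' => (jac (inCharts ι d c.a) w')ᴴ * c.imHessian (inCharts ι d c.a w')
        * jac (inCharts ι d c.a) w' := by
  filter_upwards [eventually_mem_charts hι.continuous hw hwc] with w' hw'
  exact metricMatrix_inducedMetric hι hd hc hw'.1 hw'.2

theorem inducedMetric_id (g : TangentPairing r X) : inducedMetric (s := r) g id = g := by
  funext x u v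
  simp [inducedMetric]

theorem differentiableAt_metricMatrix_inducedMetric (hι : ContMDiff 𝓘(ℂ, Cn s) 𝓘(ℂ, Cn r) ω ι)
    (hd : d ∈ holCharts s S) (hw : w ∈ d.target) :
    DifferentiableAt ℝ (metricMatrix (inducedMetric (s := s) K.metric ι) d) w := by
  obtain ⟨c, hc, hwc⟩ := K.cover (ι (d.symm w))
  have hf := contDiffAt_inCharts hι hd c.a_mem hw hwc
  have hJ := differentiableAt_real_matrix (differentiableAt_jac hf)
  have hH := differentiableAt_matrix_comp (c.differentiableAt_imHessian (inCharts_mem_target hwc))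
    ((hf.differentiableAt (by simp)).restrictScalars ℝ)
  exact (metricMatrix_inducedMetric_eventuallyEq hι hd hc hw hwc).differentiableAt_iff.2
    (differentiableAt_matrix_mul (differentiableAt_matrix_mul
      (differentiableAt_matrix_conjTranspose hJ) hH) hJ)

variable [IsManifold 𝓘(ℂ, Cn r) ω X] [IsManifold 𝓘(ℂ, Cn s) ω S]

theorem posDef_metricMatrix_inducedMetric
    (hι : Manifold.IsImmersion 𝓘(ℂ, Cn s) 𝓘(ℂ, Cn r) ω ι) (hd : d ∈ holCharts s S)
    (hw : w ∈ d.target) : (metricMatrix (inducedMetric (s := s) K.metric ι) d w).PosDef := by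
  obtain ⟨c, hc, hwc⟩ := K.cover (ι (d.symm w))
  rw [metricMatrix_inducedMetric hι.contMDiff hd hc hw hwc]
  exact (c.posDef_imHessian (inCharts_mem_target hwc)).conjTranspose_mul_mul_same
    (jac_mulVec_injective (fderiv_inCharts_injective hι hd c.a_mem hw hwc))

theorem chernIsLeviCivita_inducedMetric (K : SpecialKahlerStructure r X)
    (hι : Manifold.IsImmersion 𝓘(ℂ, Cn s) 𝓘(ℂ, Cn r) ω ι) :
    ChernIsLeviCivita (inducedMetric (s := s) K.metric ι) := by
  intro d hd w hw u v
  constructor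
  · obtain ⟨c, hc, hwc⟩ := K.cover (ι (d.symm w))
    have hz := inCharts_mem_target hwc
    rw [chernConn, (chernForm_congr (metricMatrix_inducedMetric_eventuallyEq hι.contMDiff hd hc hw
      hwc)).eq_of_nhds]
    exact act_chernForm_jac_comm (contDiffAt_inCharts hι.contMDiff hd c.a_mem hw hwc)
      (c.differentiableAt_imHessian hz) (c.matrixDel_imHessian_mulVec_comm hz) u v
  · intro i j
    have hdiff := differentiableAt_metricMatrix_inducedMetric (K := K) hι.contMDiff hd hw
    have hherm : ∀ᶠ w' in 𝓝 w,
        (metricMatrix (inducedMetric (s := s) K.metric ι) d w').IsHermitian := by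
      filter_upwards [d.open_target.mem_nhds hw] with w' hw'
      exact (posDef_metricMatrix_inducedMetric hι hd hw').isHermitian
    rw [← fderiv_matrix_apply hdiff, fderiv_eq_mul_chernForm_add hdiff hherm
      ((Matrix.isUnit_iff_isUnit_det _).1 (posDef_metricMatrix_inducedMetric hι hd hw).isUnit),
      chernConn]

theorem chernIsLeviCivita_metric (K : SpecialKahlerStructure r X) :
    ChernIsLeviCivita K.metric := by
  simpa only [inducedMetric_id] using
    chernIsLeviCivita_inducedMetric (ι := (id : X → X)) K Manifold.IsImmersion.id

end InducedMetric

/-- The imaginary part of a point of Siegel's upper half-space, with complex entries. -/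
noncomputable def SiegelSpace.imMatrix {r : ℕ} (τ₀ : SiegelSpace r) : Matrix (Fin r) (Fin r) ℂ :=
  (τ₀.1.map Complex.im).map Complex.ofReal

theorem SiegelSpace.posDef_imMatrix {r : ℕ} (τ₀ : SiegelSpace r) : τ₀.imMatrix.PosDef :=
  posDef_map_ofReal τ₀.2.2

/-- The special coordinates `c` of `K` are adapted to `ι` at the point with coordinates `w` in the
chart `d`: near that point, the period matrix they define is constantly `τ₀` along `ι`. -/
structure IsAdaptedChartAt {r s : ℕ} {X : Type*} [TopologicalSpace X] [ChartedSpace (Cn r) X]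
    {S : Type*} [TopologicalSpace S] (K : SpecialKahlerStructure r X) (τ₀ : SiegelSpace r)
    (ι : S → X) (d : OpenPartialHomeomorph S (Cn s)) (w : Cn s) (c : SpecialChart r X) : Prop where
  mem_charts : c ∈ K.charts
  mem_source : ι (d.symm w) ∈ c.a.source
  hessian_eq : ∀ᶠ w' in 𝓝 w, hessian c.F (inCharts ι d c.a w') = τ₀.1

/-- The Jacobian, along `ι`, of the change from the chart `e` to the chart `e'`: it trivializes the
restriction to `S` of the tangent bundle of `X`. -/
noncomputable def transitionJac {n s : ℕ} {X S : Type*} [TopologicalSpace X]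
    [TopologicalSpace S] (ι : S → X) (d : OpenPartialHomeomorph S (Cn s))
    (e e' : OpenPartialHomeomorph X (Cn n)) (w : Cn s) : Matrix (Fin n) (Fin n) ℂ :=
  jac (inCharts id e e') (inCharts ι d e w)

theorem chernForm_conjTranspose_mul_mul_of_matrixDel_eq_zero {k m : ℕ} {z : Cn k}
    {J H : Cn k → Matrix (Fin m) (Fin m) ℂ} (hJ : DifferentiableAt ℂ J z)
    (hH : DifferentiableAt ℝ H z) (hJdet : IsUnit (J z).det) (hHdet : IsUnit (H z).det) {v : Cn k}
    (hv : matrixDel H z v = 0) :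
    chernForm (fun z' => (J z')ᴴ * H z' * J z') z v = (J z)⁻¹ * fderiv ℂ J z v := by
  have hJHdet : IsUnit ((J z)ᴴ * H z).det := by
    rw [Matrix.det_mul, Matrix.det_conjTranspose]
    exact hJdet.star.mul hHdet
  rw [chernForm_conjTranspose_mul_mul hJ hH, hv, Matrix.zero_mul, zero_add, Matrix.mul_inv_rev,
    ← Matrix.mul_assoc (J z)ᴴ, Matrix.mul_assoc,
    Matrix.nonsing_inv_mul_cancel_left _ _ hJHdet]

section TransitionJac

variable {n s : ℕ} {X : Type*} [TopologicalSpace X] [ChartedSpace (Cn n) X]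
  {S : Type*} [TopologicalSpace S]
  {e e' : OpenPartialHomeomorph X (Cn n)} {ι : S → X} {d : OpenPartialHomeomorph S (Cn s)}
  {w : Cn s}

theorem isUnit_det_jac_transition [IsManifold 𝓘(ℂ, Cn n) ω X] {z : Cn n}
    (he : e ∈ holCharts n X) (he' : e' ∈ holCharts n X) (hz : z ∈ e.target)
    (hze' : e.symm z ∈ e'.source) : IsUnit (jac (inCharts id e e') z).det :=
  (Matrix.isUnit_iff_isUnit_det _).1 <| Matrix.mulVec_injective_iff_isUnit.1 <|
    jac_mulVec_injective <| fderiv_inCharts_injective Manifold.IsImmersion.id he he' hz hze'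

theorem isUnit_det_transitionJac [IsManifold 𝓘(ℂ, Cn n) ω X] (he : e ∈ holCharts n X)
    (he' : e' ∈ holCharts n X) (hwe : ι (d.symm w) ∈ e.source) (hwe' : ι (d.symm w) ∈ e'.source) :
    IsUnit (transitionJac ι d e e' w).det :=
  isUnit_det_jac_transition he he' (inCharts_mem_target hwe) (by rwa [symm_inCharts hwe])

theorem contDiffAt_transitionJac_apply [ChartedSpace (Cn s) S]
    (hι : ContMDiff 𝓘(ℂ, Cn s) 𝓘(ℂ, Cn n) ω ι) (hd : d ∈ holCharts s S) (he : e ∈ holCharts n X)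
    (he' : e' ∈ holCharts n X) (hw : w ∈ d.target) (hwe : ι (d.symm w) ∈ e.source)
    (hwe' : ι (d.symm w) ∈ e'.source) (i j : Fin n) :
    ContDiffAt ℂ ω (fun w' => transitionJac ι d e e' w' i j) w :=
  (contDiffAt_jac_apply (contDiffAt_transition he he' hwe hwe') i j).comp w
    (contDiffAt_inCharts hι hd he hw hwe)

theorem differentiableAt_transitionJac [ChartedSpace (Cn s) S]
    (hι : ContMDiff 𝓘(ℂ, Cn s) 𝓘(ℂ, Cn n) ω ι) (hd : d ∈ holCharts s S) (he : e ∈ holCharts n X)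
    (he' : e' ∈ holCharts n X) (hw : w ∈ d.target) (hwe : ι (d.symm w) ∈ e.source)
    (hwe' : ι (d.symm w) ∈ e'.source) :
    DifferentiableAt ℂ (transitionJac ι d e e') w :=
  differentiableAt_matrix.2 fun i j =>
    (contDiffAt_transitionJac_apply hι hd he he' hw hwe hwe' i j).differentiableAt (by simp)

theorem jac_inCharts_eventuallyEq_mul [ChartedSpace (Cn s) S]
    (hι : ContMDiff 𝓘(ℂ, Cn s) 𝓘(ℂ, Cn n) ω ι) (hd : d ∈ holCharts s S) (he : e ∈ holCharts n X)
    (he' : e' ∈ holCharts n X) (hw : w ∈ d.target) (hwe : ι (d.symm w) ∈ e.source)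
    (hwe' : ι (d.symm w) ∈ e'.source) :
    jac (inCharts ι d e')
      =ᶠ[𝓝 w] fun w' => transitionJac ι d e e' w' * jac (inCharts ι d e) w' := by
  filter_upwards [eventually_mem_charts hι.continuous hw hwe,
    eventually_mem_charts hι.continuous hw hwe'] with w' h h'
  exact jac_inCharts_eq_mul hι hd he he' h.1 h.2 h'.2

end TransitionJac

section AdaptedChart

variable {r s : ℕ} {X : Type*} [TopologicalSpace X] [ChartedSpace (Cn r) X]
  {S : Type*} [TopologicalSpace S]
  {K : SpecialKahlerStructure r X} {c : SpecialChart r X}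
  {ι : S → X} {d : OpenPartialHomeomorph S (Cn s)} {e : OpenPartialHomeomorph X (Cn r)}
  {w : Cn s} {τ : X → SiegelSpace r} {τ₀ : SiegelSpace r}

theorem exists_isAdaptedChartAt (hτ : IsPeriodMap K τ) (hι : Continuous ι)
    (hfib : ∀ x, τ (ι x) = τ₀) (hw : w ∈ d.target) : ∃ c, IsAdaptedChartAt K τ₀ ι d w c := by
  obtain ⟨c, hc, hwc, hev⟩ := hτ (ι (d.symm w))
  have hcont : ContinuousAt (fun w' => ι (d.symm w')) w :=
    hι.continuousAt.comp (d.continuousAt_symm hw)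
  refine ⟨c, hc, hwc, ?_⟩
  filter_upwards [hcont.eventually hev] with w' hw'
  rw [hfib] at hw'
  exact hw'.symm

theorem chernConn_metric_of_matrixDel_eq_zero [IsManifold 𝓘(ℂ, Cn r) ω X] {z v : Cn r}
    (hc : c ∈ K.charts) (he : e ∈ holCharts r X) (hz : z ∈ e.target)
    (hzc : e.symm z ∈ c.a.source)
    (hv : matrixDel c.imHessian (inCharts id e c.a z) (fderiv ℂ (inCharts id e c.a) z v) = 0) :
    chernConn K.metric e z v
      = (jac (inCharts id e c.a) z)⁻¹ * fderiv ℂ (jac (inCharts id e c.a)) z v := by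
  have hφ := contDiffAt_inCharts (ι := (id : X → X)) contMDiff_id he c.a_mem hz hzc
  have hφ' := hφ.differentiableAt (by simp)
  have hmem : inCharts id e c.a z ∈ c.a.target := inCharts_mem_target (ι := (id : X → X)) hzc
  have hH := c.differentiableAt_imHessian hmem
  have hmetric := metricMatrix_inducedMetric_eventuallyEq (K := K) (ι := (id : X → X))
    contMDiff_id he hc hz hzc
  rw [inducedMetric_id] at hmetric
  rw [chernConn, (chernForm_congr hmetric).eq_of_nhds]
  exact chernForm_conjTranspose_mul_mul_of_matrixDel_eq_zero (differentiableAt_jac hφ)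
    (differentiableAt_matrix_comp hH (hφ'.restrictScalars ℝ))
    (isUnit_det_jac_transition he c.a_mem hz hzc)
    ((Matrix.isUnit_iff_isUnit_det _).1 (c.posDef_imHessian hmem).isUnit)
    ((matrixDel_comp hH hφ' v).trans hv)

namespace IsAdaptedChartAt

theorem eventually (h : IsAdaptedChartAt K τ₀ ι d w c) (hι : Continuous ι) (hw : w ∈ d.target) :
    ∀ᶠ w' in 𝓝 w, IsAdaptedChartAt K τ₀ ι d w' c := by
  filter_upwards [h.hessian_eq.eventually_nhds, eventually_mem_charts hι hw h.mem_source]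
    with w' hhess hmem using ⟨h.mem_charts, hmem.2, hhess⟩

theorem imHessian_eventuallyEq (h : IsAdaptedChartAt K τ₀ ι d w c) :
    (fun w' => c.imHessian (inCharts ι d c.a w')) =ᶠ[𝓝 w] fun _ => τ₀.imMatrix := by
  filter_upwards [h.hessian_eq] with w' hw'
  rw [SpecialChart.imHessian, hw', SiegelSpace.imMatrix]

variable [ChartedSpace (Cn s) S]

theorem matrixDel_imHessian_eq_zero (h : IsAdaptedChartAt K τ₀ ι d w c)
    (hι : ContMDiff 𝓘(ℂ, Cn s) 𝓘(ℂ, Cn r) ω ι) (hd : d ∈ holCharts s S) (hw : w ∈ d.target)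
    (u : Cn s) :
    matrixDel c.imHessian (inCharts ι d c.a w) (fderiv ℂ (inCharts ι d c.a) w u) = 0 := by
  rw [← matrixDel_comp (c.differentiableAt_imHessian (inCharts_mem_target h.mem_source))
      ((contDiffAt_inCharts hι hd c.a_mem hw h.mem_source).differentiableAt (by simp)),
    matrixDel_congr h.imHessian_eventuallyEq, matrixDel_const]

variable [IsManifold 𝓘(ℂ, Cn r) ω X]

theorem isFlatImmersionAt [IsManifold 𝓘(ℂ, Cn s) ω S] (h : IsAdaptedChartAt K τ₀ ι d w c)
    (hι : Manifold.IsImmersion 𝓘(ℂ, Cn s) 𝓘(ℂ, Cn r) ω ι) (hd : d ∈ holCharts s S)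
    (hw : w ∈ d.target) :
    IsFlatImmersionAt (inducedMetric (s := s) K.metric ι) d w τ₀.imMatrix (inCharts ι d c.a) where
  posDef := τ₀.posDef_imMatrix
  contDiffAt := contDiffAt_inCharts hι.contMDiff hd c.a_mem hw h.mem_source
  fderiv_injective := fderiv_inCharts_injective hι hd c.a_mem hw h.mem_source
  metricMatrix_eq := by
    filter_upwards [h.imHessian_eventuallyEq,
      metricMatrix_inducedMetric_eventuallyEq hι.contMDiff hd h.mem_charts hw h.mem_source]
      with w' hτ hmetric
    rw [hmetric, hτ]

theorem restrictedConn_eq (h : IsAdaptedChartAt K τ₀ ι d w c)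
    (hι : ContMDiff 𝓘(ℂ, Cn s) 𝓘(ℂ, Cn r) ω ι) (hd : d ∈ holCharts s S) (he : e ∈ holCharts r X)
    (hw : w ∈ d.target) (hwe : ι (d.symm w) ∈ e.source) (u : Cn s) :
    restrictedConn K.metric ι d e w u
      = (transitionJac ι d e c.a w)⁻¹ * fderiv ℂ (transitionJac ι d e c.a) w u := by
  have hφ := contDiffAt_transition he c.a_mem hwe h.mem_source
  have hf := (contDiffAt_inCharts hι hd he hw hwe).differentiableAt (by simp)
  have hcomp := inCharts_eventuallyEq_comp (e' := c.a) hι.continuous hw hwe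
  have hzero := h.matrixDel_imHessian_eq_zero hι hd hw u
  rw [hcomp.fderiv_eq, fderiv_fun_comp w (hφ.differentiableAt (by simp)) hf,
    hcomp.eq_of_nhds, ContinuousLinearMap.comp_apply] at hzero
  rw [restrictedConn, ConnForm.pullback, chernConn_metric_of_matrixDel_eq_zero h.mem_charts he
    (inCharts_mem_target hwe) (by rw [symm_inCharts hwe]; exact h.mem_source) hzero,
    ← fderiv_matrix_comp (differentiableAt_jac hφ) hf]
  rfl

theorem curvature_restrictedConn (h : IsAdaptedChartAt K τ₀ ι d w c)
    (hι : ContMDiff 𝓘(ℂ, Cn s) 𝓘(ℂ, Cn r) ω ι) (hd : d ∈ holCharts s S) (he : e ∈ holCharts r X)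
    (hw : w ∈ d.target) (hwe : ι (d.symm w) ∈ e.source) (u v : Cn s) :
    (restrictedConn K.metric ι d e).curvature w u v = 0 := by
  have hG := differentiableAt_transitionJac hι hd he c.a_mem hw hwe h.mem_source
  have hdet := isUnit_det_transitionJac he c.a_mem hwe h.mem_source
  have hgauge : ∀ᶠ w' in 𝓝 w, ∀ u, restrictedConn K.metric ι d e w' u
      = (transitionJac ι d e c.a w')⁻¹ * fderiv ℝ (transitionJac ι d e c.a) w' u := by
    filter_upwards [h.eventually hι.continuous hw, eventually_mem_charts hι.continuous hw hwe]
      with w' h' hmem u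
    rw [h'.restrictedConn_eq hι hd he hmem.1 hmem.2, fderiv_real_matrix_apply
      (differentiableAt_transitionJac hι hd he c.a_mem hmem.1 hmem.2 h'.mem_source)]
  have hinv : ∀ᶠ w' in 𝓝 w, (transitionJac ι d e c.a w')⁻¹ * transitionJac ι d e c.a w' = 1 := by
    filter_upwards [h.eventually hι.continuous hw, eventually_mem_charts hι.continuous hw hwe]
      with w' h' hmem
    exact Matrix.nonsing_inv_mul _ (isUnit_det_transitionJac he c.a_mem hmem.2 h'.mem_source)
  rw [ConnForm.curvature_of_eq_mul_fderiv hgauge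
      (fun i j => ((contDiffAt_transitionJac_apply hι hd he c.a_mem hw hwe h.mem_source i
        j).restrict_scalars ℝ).of_le le_top)
      (differentiableAt_matrix_inv (differentiableAt_real_matrix hG) hdet) hinv,
    Matrix.mul_nonsing_inv _ hdet]
  simp only [sub_self, Matrix.mul_zero, Matrix.zero_mul]

theorem transitionJac_mulVec_covariantDeriv (h : IsAdaptedChartAt K τ₀ ι d w c)
    (hι : ContMDiff 𝓘(ℂ, Cn s) 𝓘(ℂ, Cn r) ω ι) (hd : d ∈ holCharts s S) (he : e ∈ holCharts r X)
    (hw : w ∈ d.target) (hwe : ι (d.symm w) ∈ e.source) (u v : Cn s) :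
    transitionJac ι d e c.a w *ᵥ
        (fderiv ℝ (fun w' => fderiv ℂ (inCharts ι d e) w' v) w u
          + act (restrictedConn K.metric ι d e w u) (fderiv ℂ (inCharts ι d e) w v)).ofLp
      = (fderiv ℂ (fderiv ℂ (inCharts ι d c.a)) w u v).ofLp := by
  have hG := differentiableAt_transitionJac hι hd he c.a_mem hw hwe h.mem_source
  have hdet := isUnit_det_transitionJac he c.a_mem hwe h.mem_source
  have hf := contDiffAt_inCharts hι hd he hw hwe
  have hjac := jac_inCharts_eventuallyEq_mul hι hd he c.a_mem hw hwe h.mem_source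
  rw [← fderiv_jac_mulVec (contDiffAt_inCharts hι hd c.a_mem hw h.mem_source), hjac.fderiv_eq,
    fderiv_matrix_mul hG (differentiableAt_jac hf), fderiv_fderiv_apply hf,
    h.restrictedConn_eq hι hd he hw hwe, act, WithLp.ofLp_add, Matrix.mulVec_add,
    Matrix.mulVec_mulVec, Matrix.mul_nonsing_inv_cancel_left _ _ hdet, Matrix.add_mulVec,
    ← fderiv_jac_mulVec hf, ← jac_mulVec, Matrix.mulVec_mulVec, Matrix.mulVec_mulVec, add_comm]

theorem exists_tangent_iff (h : IsAdaptedChartAt K τ₀ ι d w c)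
    (hι : ContMDiff 𝓘(ℂ, Cn s) 𝓘(ℂ, Cn r) ω ι) (hd : d ∈ holCharts s S) (he : e ∈ holCharts r X)
    (hw : w ∈ d.target) (hwe : ι (d.symm w) ∈ e.source) (u v : Cn s) :
    (∃ t : Cn s, fderiv ℝ (fun w' => fderiv ℂ (inCharts ι d e) w' v) w u
        + act (restrictedConn K.metric ι d e w u) (fderiv ℂ (inCharts ι d e) w v)
      = fderiv ℂ (inCharts ι d e) w t) ↔
    ∃ t : Cn s, fderiv ℂ (fderiv ℂ (inCharts ι d c.a)) w u v
      = fderiv ℂ (inCharts ι d c.a) w t := by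
  have hinj : Function.Injective (transitionJac ι d e c.a w).mulVec :=
    Matrix.mulVec_injective_iff_isUnit.2 <| (Matrix.isUnit_iff_isUnit_det _).2 <|
      isUnit_det_transitionJac he c.a_mem hwe h.mem_source
  have hjac (t : Cn s) : (fderiv ℂ (inCharts ι d c.a) w t).ofLp
      = transitionJac ι d e c.a w *ᵥ (fderiv ℂ (inCharts ι d e) w t).ofLp := by
    rw [← jac_mulVec, ← jac_mulVec, Matrix.mulVec_mulVec,
      (jac_inCharts_eventuallyEq_mul hι hd he c.a_mem hw hwe h.mem_source).eq_of_nhds]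
  refine exists_congr fun t => ?_
  rw [← (WithLp.ofLp_injective 2).eq_iff, ← hinj.eq_iff,
    h.transitionJac_mulVec_covariantDeriv hι hd he hw hwe, ← hjac, (WithLp.ofLp_injective 2).eq_iff]

end IsAdaptedChartAt

end AdaptedChart

section FiberCurvature

variable {r s : ℕ} {X : Type*} [TopologicalSpace X] [ChartedSpace (Cn r) X]
  [IsManifold 𝓘(ℂ, Cn r) ω X]
  {S : Type*} [TopologicalSpace S] [ChartedSpace (Cn s) S]
  {K : SpecialKahlerStructure r X} {ι : S → X} {τ : X → SiegelSpace r} {τ₀ : SiegelSpace r}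

theorem restrictedTangentFlat_of_period_eq (hτ : IsPeriodMap K τ)
    (hι : ContMDiff 𝓘(ℂ, Cn s) 𝓘(ℂ, Cn r) ω ι) (hfib : ∀ x, τ (ι x) = τ₀) :
    RestrictedTangentFlat (s := s) K.metric ι := by
  intro d hd e he w hw hwe u v
  obtain ⟨c, h⟩ := exists_isAdaptedChartAt hτ hι.continuous hfib hw
  exact h.curvature_restrictedConn hι hd he hw hwe u v

variable [IsManifold 𝓘(ℂ, Cn s) ω S]

theorem nakanoNonpos_of_period_eq (hτ : IsPeriodMap K τ)
    (hι : Manifold.IsImmersion 𝓘(ℂ, Cn s) 𝓘(ℂ, Cn r) ω ι) (hfib : ∀ x, τ (ι x) = τ₀) :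
    NakanoNonpos (inducedMetric (s := s) K.metric ι) := by
  intro d hd w hw u
  obtain ⟨c, h⟩ := exists_isAdaptedChartAt hτ hι.contMDiff.continuous hfib hw
  exact (h.isFlatImmersionAt hι hd hw).sum_riemann_nonpos u

theorem ricciNonpos_of_period_eq (hτ : IsPeriodMap K τ)
    (hι : Manifold.IsImmersion 𝓘(ℂ, Cn s) 𝓘(ℂ, Cn r) ω ι) (hfib : ∀ x, τ (ι x) = τ₀) :
    RicciNonpos (inducedMetric (s := s) K.metric ι) := by
  intro d hd w hw u
  obtain ⟨c, h⟩ := exists_isAdaptedChartAt hτ hι.contMDiff.continuous hfib hw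
  exact (h.isFlatImmersionAt hι hd hw).sum_ricci_nonpos u

theorem isFlat_iff_isTotallyGeodesic_of_period_eq (hτ : IsPeriodMap K τ)
    (hι : Manifold.IsImmersion 𝓘(ℂ, Cn s) 𝓘(ℂ, Cn r) ω ι) (hfib : ∀ x, τ (ι x) = τ₀) :
    IsFlat (inducedMetric (s := s) K.metric ι) ↔ IsTotallyGeodesic (s := s) K.metric ι := by
  constructor
  · intro hflat d hd e he w hw hwe u v
    obtain ⟨c, h⟩ := exists_isAdaptedChartAt hτ hι.contMDiff.continuous hfib hw
    exact (h.exists_tangent_iff hι.contMDiff hd he hw hwe u v).2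
      ((h.isFlatImmersionAt hι hd hw).curvature_eq_zero_iff.1 (hflat d hd w hw) u v)
  · intro hgeo d hd w hw
    obtain ⟨c, h⟩ := exists_isAdaptedChartAt hτ hι.contMDiff.continuous hfib hw
    exact (h.isFlatImmersionAt hι hd hw).curvature_eq_zero_iff.2 fun u v =>
      (h.exists_tangent_iff hι.contMDiff hd c.a_mem hw h.mem_source u v).1
        (hgeo d hd c.a c.a_mem w hw h.mem_source u v)

end FiberCurvature

end SpecialGeometry

theorem mainTheorem7_general {r s : ℕ}
    {X : Type*} [TopologicalSpace X] [ChartedSpace (Cn r) X] [IsManifold 𝓘(ℂ, Cn r) ω X]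
    (K : SpecialKahlerStructure r X) (τ : X → SiegelSpace r) (hτ : IsPeriodMap K τ)
    (τ₀ : SiegelSpace r)
    {S : Type*} [TopologicalSpace S] [ChartedSpace (Cn s) S] [IsManifold 𝓘(ℂ, Cn s) ω S]
    (ι : S → X) (hι : Manifold.IsImmersion 𝓘(ℂ, Cn s) 𝓘(ℂ, Cn r) ω ι)
    (hfib : ∀ x, τ (ι x) = τ₀) :
    (ChernIsLeviCivita K.metric ∧ RestrictedTangentFlat (s := s) K.metric ι) ∧
    (ChernIsLeviCivita (inducedMetric (s := s) K.metric ι) ∧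
      NakanoNonpos (inducedMetric (s := s) K.metric ι) ∧
      RicciNonpos (inducedMetric (s := s) K.metric ι) ∧
      BisectionalNonpos (inducedMetric (s := s) K.metric ι)) ∧
    (IsFlat (inducedMetric (s := s) K.metric ι) ↔ IsTotallyGeodesic (s := s) K.metric ι) := by
  have hnakano := nakanoNonpos_of_period_eq hτ hι hfib
  exact ⟨⟨chernIsLeviCivita_metric K, restrictedTangentFlat_of_period_eq hτ hι.contMDiff hfib⟩,
    ⟨chernIsLeviCivita_inducedMetric K hι, hnakano, ricciNonpos_of_period_eq hτ hι hfib,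
      hnakano.bisectionalNonpos⟩, isFlat_iff_isTotallyGeodesic_of_period_eq hτ hι hfib⟩

theorem mainTheorem7 {r s : ℕ}
    {X : Type*} [TopologicalSpace X] [ChartedSpace (Cn r) X] [IsManifold 𝓘(ℂ, Cn r) ω X]
    (K : SpecialKahlerStructure r X) (τ : X → SiegelSpace r) (hτ : IsPeriodMap K τ)
    (τ₀ : SiegelSpace r)
    {S : Type*} [TopologicalSpace S] [ChartedSpace (Cn s) S] [IsManifold 𝓘(ℂ, Cn s) ω S]
    (ι : S → X) (hι : Manifold.IsSmoothEmbedding 𝓘(ℂ, Cn s) 𝓘(ℂ, Cn r) ω ι)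
    (hfiber : Set.range ι = τ ⁻¹' {τ₀}) :
    (ChernIsLeviCivita K.metric ∧ RestrictedTangentFlat (s := s) K.metric ι) ∧
    (ChernIsLeviCivita (inducedMetric (s := s) K.metric ι) ∧
      NakanoNonpos (inducedMetric (s := s) K.metric ι) ∧
      RicciNonpos (inducedMetric (s := s) K.metric ι) ∧
      BisectionalNonpos (inducedMetric (s := s) K.metric ι)) ∧
    (IsFlat (inducedMetric (s := s) K.metric ι) ↔ IsTotallyGeodesic (s := s) K.metric ι) ∧
    (IsTotallyGeodesic (s := s) K.metric ι → IsHolomorphicFlat (s := s) K.metric ι) := by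
  obtain ⟨hambient, hinduced, hflat_iff⟩ := mainTheorem7_general K τ hτ τ₀ ι hι.isImmersion
    fun x => hfiber.subset (Set.mem_range_self x)
  exact ⟨hambient, hinduced, hflat_iff, fun hgeo => ⟨hι, hgeo, hflat_iff.2 hgeo⟩⟩
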